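/- Let $k$ be a field and $D=k[d_1,\dots,d_n]$ the ring of linear differential operators with constant coefficients in $k$, filtered by the order. Consider a linear first order system with constant coefficients in $m$ unknowns $y^1,\dots,y^m$, without zero order equations: a $k$-vector space $E$ of equations $\Phi\equiv\sum_{i,a}A^i_a\,d_iy^a+\sum_a B_a\,y^a=0$, regarded as elements of $D^m$, such that no nonzero $\Phi\in E$ has all $A^i_a=0$. Let $E_{\le i}\subseteq E$ be the equations of class $1,\dots,i$, that is, those containing only $y^a,d_1y^a,\dots,d_iy^a$. Assume that the system is involutive in the given coordinates: there are complements $G_i$ of $E_{\le i-1}$ in $E_{\le i}$ (equations of strict class $i$, with multiplicative variables $x^1,\dots,x^i$) such that the first prolongation $E+\sum_{j=1}^n d_jE$ is equal to $E+\sum_{i=1}^n\sum_{j\le i}d_jG_i$. Let $M=D^m/(D\,E)$. For a $D$-module generated by a given finite family, filtered by the order of operators, the characteristic ideal is the radical of the annihilator of the associated graded module over $k[\chi_1,\dots,\chi_n]$, the characteristic variety is its zero set, and the codimension $cd$ is $n$ minus the dimension of this variety ($cd(0)=\infty$); $cd(M)$ is taken with respect to the residues of $y^1,\dots,y^m$,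 and $cd(Dz)$ with respect to $z$. Put $t_s(M)=\{z\in M\mid cd(Dz)>s\}$ for $s\ge 0$, which is a submodule of $M$, and $t_{-1}(M)=M$. The module $M$ is $s$-pure if $t_s(M)=0$ and $t_{s-1}(M)=M$. Assume $cd(M)=r$. Let $D'=k[d_1,\dots,d_{n-r}]\subseteq D$, let $k(\chi_1,\dots,\chi_{n-r})$ be its field of fractions, and let $M_r$ be the module defined by the subsystem of the equations of class $1,\dots,n-r$ only, viewed over $D'$: $M_r=D'^m/(D'E_{\le n-r})$. Let $M_r\to M$ be the canonical $D'$-linear map sending the residue of each $y^a$ to its residue, and let $t(M_r)$ be the torsion submodule of the $D'$-module $M_r$. Then $M_r\to M$ maps $t(M_r)$ into $t_r(M)$ and one has the commutative diagram with exact rows and columns $$\begin{array}{ccccccc} 0\to& t(M_r)&\to& M_r&\to& k(\chi_1,\dots,\chi_{n-r})\otimes_{D'} M_r\\ &\downarrow&&\downarrow&&\downarrow\\ 0\to& t_r(M)&\to& M&\to& k(\chi_1,\dots,\chi_{n-r})\otimes_{D'} M\\ &\downarrow&&\downarrow&&\downarrow\\ &0&&0&&0 \end{array}$$ with the inclusions,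 the canonical maps $x\mapsto 1\otimes x$, and the vertical maps induced by $M_r\to M$. The same holds when $M_r$ is instead viewed over $D$, that is, when $M_r$ is replaced by the $D$-module $D^m/(D\,E_{\le n-r})$ with its torsion submodule over $D$ and its canonical $D$-linear map to $M$. Moreover, $M$ is $r$-pure if and only if $M_r$ is torsion-free, over $D'$ and, equivalently, over $D$ in the second reading. -/

import Mathlib

open scoped TensorProduct

noncomputable section

namespace PureModules

/-- The ring `D = k[d_1, ..., d_n]` of linear differential operators with coefficients in the
field of constants `k`.  The operator `d_{j+1}` is `MvPolynomial.X j`, `j : Fin n`.  The same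
polynomial ring also serves as `gr(D) = k[χ_1, ..., χ_n]`. -/
abbrev Op (k : Type*) [Field k] (n : ℕ) : Type _ := MvPolynomial (Fin n) k

/-! ### Characteristic variety, codimension, and the submodules `t_r` -/

section Codimension

variable (k : Type*) [Field k] (n : ℕ) {ι : Type*} [Fintype ι]
  {N : Type*} [AddCommGroup N] [Module (Op k n) N]

/-- Let `g` be a finite family in a `D`-module.  The module `Dg` generated by `g` is filtered by
the order of operators, and its associated graded module is the quotient of `k[χ]^ι` by the
submodule generated by the symbols (homogeneous parts of degree `q`) of the relations of
order `≤ q` between the elements of `g`.  This is that submodule. -/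
def symbolModule (g : ι → N) : Submodule (Op k n) (ι → Op k n) :=
  Submodule.span (Op k n)
    {w | ∃ (q : ℕ) (v : ι → Op k n), ∑ a, v a • g a = 0 ∧ (∀ a, (v a).totalDegree ≤ q) ∧
      w = fun a => MvPolynomial.homogeneousComponent q (v a)}

/-- The characteristic ideal of the differential module generated by `g`: the radical of the
annihilator of the associated graded module. -/
def charIdeal (g : ι → N) : Ideal (Op k n) :=
  (Module.annihilator (Op k n) ((ι → Op k n) ⧸ symbolModule k n g)).radical

/-- The dimension of the characteristic variety, i.e. of the zero set of the characteristic
ideal (`⊥` when the characteristic ideal is the unit ideal, that is, when the module is zero). -/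
def charDim (g : ι → N) : WithBot ℕ∞ := ringKrullDim (Op k n ⧸ charIdeal k n g)

open Classical in
/-- The codimension `cd(Dg)`: `n` minus the dimension of the characteristic variety; the
codimension of the zero module is `∞`. -/
def codim (g : ι → N) : ℕ∞ :=
  if charDim k n g = ⊥ then ⊤ else (n : ℕ∞) - (charDim k n g).unbotD 0

/-- The codimension `cd(Dz)` of the cyclic submodule generated by `z`. -/
def codimElem (z : N) : ℕ∞ := codim k n (fun _ : Unit => z)

/-! The next lemmas show that the elements `z` with `cd(Dz) > r` form a submodule. -/

theorem codimElem_of_charDim_le {r : ℕ∞} {z : N}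
    (h : ∃ a b : N, r < codimElem k n a ∧ r < codimElem k n b ∧
      charDim k n (fun _ : Unit => z) ≤
        max (charDim k n (fun _ : Unit => a)) (charDim k n (fun _ : Unit => b))) :
    r < codimElem k n z := by
  obtain ⟨a, b, ha, hb, h⟩ := h
  unfold codimElem codim at *
  generalize charDim k n (fun _ : Unit => z) = x at *
  generalize charDim k n (fun _ : Unit => a) = y at *
  generalize charDim k n (fun _ : Unit => b) = w at *
  have key : ∀ y : WithBot ℕ∞, (r < if y = ⊥ then ⊤ else (n : ℕ∞) - y.unbotD 0) → x ≤ y →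
      r < if x = ⊥ then ⊤ else (n : ℕ∞) - x.unbotD 0 := by
    intro y hy hxy
    by_cases hx : x = ⊥
    · rw [if_pos hx]
      exact lt_of_lt_of_le hy le_top
    · have hy' : y ≠ ⊥ := fun e => hx (le_bot_iff.mp (e ▸ hxy))
      rw [if_neg hx]
      rw [if_neg hy'] at hy
      lift x to ℕ∞ using hx
      lift y to ℕ∞ using hy'
      exact lt_of_lt_of_le hy (tsub_le_tsub_left (WithBot.coe_le_coe.mp hxy) _)
  rcases le_max_iff.mp h with h | h
  · exact key _ ha h
  · exact key _ hb h

theorem ringKrullDim_quotient_le_max {R : Type*} [CommRing R] (I J L : Ideal R)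
    (h : ∀ P : Ideal R, P.IsPrime → L ≤ P → I ≤ P ∨ J ≤ P) :
    ringKrullDim (R ⧸ L) ≤ max (ringKrullDim (R ⧸ I)) (ringKrullDim (R ⧸ J)) := by
  rw [ringKrullDim_quotient, ringKrullDim_quotient, ringKrullDim_quotient]
  refine iSup_le fun p => ?_
  have aux : ∀ K : Ideal R, K ≤ (p.head : PrimeSpectrum R).asIdeal →
      (p.length : WithBot ℕ∞) ≤ Order.krullDim (PrimeSpectrum.zeroLocus (R := R) K) := by
    intro K hK
    let q : LTSeries (PrimeSpectrum.zeroLocus (R := R) (K : Set R)) :=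
      { length := p.length
        toFun := fun i => ⟨(p i).1, fun x hx =>
          (show (p.head : PrimeSpectrum R).asIdeal ≤ (p i).1.asIdeal from p.head_le i) (hK hx)⟩
        step := fun i => p.step i }
    exact Order.LTSeries.length_le_krullDim q
  rcases h _ (p.head : PrimeSpectrum R).isPrime p.head.2 with h | h
  · exact le_max_of_le_left (aux I h)
  · exact le_max_of_le_right (aux J h)

theorem homogeneousComponent_mul_of_le {σ : Type*} {p q : ℕ} {u v : MvPolynomial σ k}
    (hu : u.totalDegree ≤ p) (hv : v.totalDegree ≤ q) :
    MvPolynomial.homogeneousComponent (p + q) (u * v) =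
      MvPolynomial.homogeneousComponent p u * MvPolynomial.homogeneousComponent q v := by
  classical
  ext d
  rw [MvPolynomial.coeff_homogeneousComponent, MvPolynomial.coeff_mul, MvPolynomial.coeff_mul]
  have hz : ∀ (w : MvPolynomial σ k) (e : σ →₀ ℕ) (s : ℕ), w.totalDegree ≤ s → s < e.degree →
      MvPolynomial.coeff e w = 0 := by
    intro w e s hw he
    apply MvPolynomial.coeff_eq_zero_of_totalDegree_lt
    have : e.degree = ∑ i ∈ e.support, e i := rfl
    omega
  split_ifs with hd
  · refine Finset.sum_congr rfl fun x hx => ?_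
    have hx' : x.1.degree + x.2.degree = p + q := by
      rw [← hd, ← Finset.HasAntidiagonal.mem_antidiagonal.mp hx, map_add]
    rw [MvPolynomial.coeff_homogeneousComponent, MvPolynomial.coeff_homogeneousComponent]
    rcases lt_trichotomy x.1.degree p with h | h | h
    · rw [hz v x.2 q hv (by omega)]; simp
    · rw [if_pos h, if_pos (by omega)]
    · rw [hz u x.1 p hu h]; simp
  · refine (Finset.sum_eq_zero fun x hx => ?_).symm
    have hx' : x.1.degree + x.2.degree ≠ p + q := by
      rwa [← map_add, Finset.HasAntidiagonal.mem_antidiagonal.mp hx]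
    rw [MvPolynomial.coeff_homogeneousComponent, MvPolynomial.coeff_homogeneousComponent]
    by_cases h : x.1.degree = p
    · rw [if_neg (show ¬ x.2.degree = q by omega), mul_zero]
    · rw [if_neg h, zero_mul]

theorem mem_symbolModule_mul {a b z : N}
    (hz : ∀ u v : Op k n, u • a = 0 → v • b = 0 → (u * v) • z = 0)
    {w w' : Unit → Op k n} (hw : w ∈ symbolModule k n (fun _ : Unit => a))
    (hw' : w' ∈ symbolModule k n (fun _ : Unit => b)) :
    w * w' ∈ symbolModule k n (fun _ : Unit => z) := by
  induction hw using Submodule.span_induction with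
  | mem w hw =>
    obtain ⟨p, u, hu, hp, rfl⟩ := hw
    induction hw' using Submodule.span_induction with
    | mem w' hw' =>
      obtain ⟨q, v, hv, hq, rfl⟩ := hw'
      refine Submodule.subset_span ⟨p + q, u * v, ?_, fun i =>
        (MvPolynomial.totalDegree_mul _ _).trans (add_le_add (hp i) (hq i)), ?_⟩
      · simpa using hz (u ()) (v ()) (by simpa using hu) (by simpa using hv)
      · funext i
        exact (homogeneousComponent_mul_of_le k (hp i) (hq i)).symm
    | zero => rw [mul_zero]; exact Submodule.zero_mem _
    | add x y _ _ hx hy => rw [mul_add]; exact Submodule.add_mem _ hx hy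
    | smul c x _ hx => rw [mul_smul_comm]; exact Submodule.smul_mem _ _ hx
  | zero => rw [zero_mul]; exact Submodule.zero_mem _
  | add x y _ _ hx hy => rw [add_mul]; exact Submodule.add_mem _ hx hy
  | smul c x _ hx => rw [smul_mul_assoc]; exact Submodule.smul_mem _ _ hx

theorem mem_annihilator_symbol {z : N} {p : Op k n} :
    p ∈ Module.annihilator (Op k n)
        ((Unit → Op k n) ⧸ symbolModule k n (fun _ : Unit => z)) ↔
      (fun _ : Unit => p) ∈ symbolModule k n (fun _ : Unit => z) := by
  rw [Submodule.annihilator_quotient, Submodule.mem_colon]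
  constructor
  · intro h
    simpa [Pi.smul_def] using h (fun _ => 1) trivial
  · intro h v _
    have : p • v = v () • (fun _ : Unit => p) := by
      funext i
      simp [mul_comm]
    rw [this]
    exact Submodule.smul_mem _ _ h

theorem lt_codimElem_of_mul {r : ℕ∞} {a b z : N} (ha : r < codimElem k n a)
    (hb : r < codimElem k n b)
    (hz : ∀ u v : Op k n, u • a = 0 → v • b = 0 → (u * v) • z = 0) :
    r < codimElem k n z := by
  refine codimElem_of_charDim_le k n ⟨a, b, ha, hb, ringKrullDim_quotient_le_max _ _ _ ?_⟩
  intro P hP hle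
  unfold charIdeal at *
  rw [hP.radical_le_iff] at *
  rw [hP.radical_le_iff]
  by_contra! hcon
  obtain ⟨⟨p, hp, hpP⟩, ⟨q, hq, hqP⟩⟩ :=
    And.intro (SetLike.not_le_iff_exists.mp hcon.1) (SetLike.not_le_iff_exists.mp hcon.2)
  rw [mem_annihilator_symbol] at hp hq
  have := (mem_annihilator_symbol k n).mpr (mem_symbolModule_mul k n hz hp hq)
  rcases hP.mem_or_mem (hle this) with h | h
  · exact hpP h
  · exact hqP h

theorem codimElem_zero : codimElem k n (0 : N) = ⊤ := by
  have h : charIdeal k n (fun _ : Unit => (0 : N)) = ⊤ := by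
    rw [charIdeal, Ideal.radical_eq_top, Ideal.eq_top_iff_one, mem_annihilator_symbol]
    refine Submodule.subset_span ⟨0, fun _ => 1, by simp, fun _ => by simp, ?_⟩
    funext i
    simp
  have : charDim k n (fun _ : Unit => (0 : N)) = ⊥ := by
    rw [charDim, h]
    exact ringKrullDim_eq_bot_of_subsingleton
  simp [codimElem, codim, this]

/-- `t_r(N) = {z ∈ N | cd(Dz) > r}`. -/
def tSub (N : Type*) [AddCommGroup N] [Module (Op k n) N] (r : ℕ) : Submodule (Op k n) N where
  carrier := {z | (r : ℕ∞) < codimElem k n z}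
  zero_mem' := by
    show (r : ℕ∞) < codimElem k n (0 : N)
    rw [codimElem_zero]
    exact ENat.natCast_lt_top r
  add_mem' := fun {a b} ha hb => lt_codimElem_of_mul k n ha hb fun u v hu hv => by
    rw [smul_add, mul_smul, mul_smul, hv, smul_zero, add_zero, smul_comm, hu, smul_zero]
  smul_mem' := fun c a ha => lt_codimElem_of_mul k n ha ha fun u v hu hv => by
    rw [smul_comm, mul_smul, hv, smul_zero, smul_zero]

/-- `N` is `r`-pure: `t_r(N) = 0` and `t_{r-1}(N) = N`, where `t_{-1}(N) = N` by convention. -/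
def IsPure (N : Type*) [AddCommGroup N] [Module (Op k n) N] (r : ℕ) : Prop :=
  tSub k n N r = ⊥ ∧ ∀ s : ℕ, s + 1 = r → tSub k n N s = ⊤

end Codimension

/-! ### First order systems, classes, involution -/

/-- A linear first order system with constant coefficients, without zero order equations, in `n`
independent variables and the `m` unknowns `y^1, ..., y^m`.  It is given by the `k`-vector space
of its equations `Φ ≡ ∑ A^{i}_a d_i y^a + ∑ B_a y^a = 0`, which are row vectors in `D^m` (the
coefficient of `y^a` is the component with index `a`). -/
structure FirstOrderSystem (k : Type*) [Field k] (n m : ℕ) where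
  eqns : Submodule k (Fin m → Op k n)
  order_le_one : ∀ v ∈ eqns, ∀ a, (v a).totalDegree ≤ 1
  no_zero_order : ∀ v ∈ eqns, (∀ a, (v a).totalDegree = 0) → v = 0

/-- The subring `D' = k[d_1, ..., d_p]` of `D = k[d_1, ..., d_n]`. -/
abbrev SubOp (k : Type*) [Field k] (n p : ℕ) : Subalgebra k (Op k n) :=
  MvPolynomial.supported k {j : Fin n | (j : ℕ) < p}

/-- The field `k(χ_1, ..., χ_p)` of fractions of `k[d_1, ..., d_p]`. -/
abbrev RatField (k : Type*) [Field k] (n p : ℕ) : Type _ := FractionRing (SubOp k n p)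

/-- The formal derivative `Φ ↦ d_{j+1} Φ` on row vectors of operators. -/
def formalDeriv (k : Type*) [Field k] {n : ℕ} (m : ℕ) (j : Fin n) :
    (Fin m → Op k n) →ₗ[k] (Fin m → Op k n) :=
  LinearMap.compLeft (LinearMap.mulLeft k (MvPolynomial.X j : Op k n)) (Fin m)

namespace FirstOrderSystem

variable {k : Type*} [Field k] {n m : ℕ} (S : FirstOrderSystem k n m)

/-- The equations of class `1, ..., i`, i.e. those that contain only the jets
`y^a, d_1 y^a, ..., d_i y^a`. -/
def eqnsUpTo (i : ℕ) : Submodule k (Fin m → Op k n) where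
  carrier := {v | v ∈ S.eqns ∧ ∀ a, v a ∈ SubOp k n i}
  zero_mem' := ⟨Submodule.zero_mem _, fun _ => zero_mem _⟩
  add_mem' := fun hv hw => ⟨Submodule.add_mem _ hv.1 hw.1, fun a => add_mem (hv.2 a) (hw.2 a)⟩
  smul_mem' := fun c _ hv =>
    ⟨Submodule.smul_mem _ c hv.1, fun a => Subalgebra.smul_mem _ (hv.2 a) c⟩

/-- The first prolongation: all the equations `Φ` together with all the `d_j Φ`. -/
def prolongation : Submodule k (Fin m → Op k n) :=
  S.eqns ⊔ ⨆ j : Fin n, S.eqns.map (formalDeriv k m j)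

/-- The system is involutive (in the given coordinates): one can choose, for `i = n, ..., 1`, a
maximal set of equations that can be solved with respect to the jets of class `i` (they span a
complement `G i` of the equations of lower class in the equations of class `≤ i`), such that the
first prolongation is already obtained by prolonging the equations of each class `i` with
respect to their multiplicative variables `x^1, ..., x^i` only.  The value of `i : Fin n` is one
less than the class. -/
def IsInvolutive : Prop :=
  ∃ G : Fin n → Submodule k (Fin m → Op k n),
    (∀ i : Fin n, Disjoint (S.eqnsUpTo i) (G i) ∧
      S.eqnsUpTo i ⊔ G i = S.eqnsUpTo (i + 1)) ∧
    S.prolongation = S.eqns ⊔ ⨆ i : Fin n, ⨆ j : Fin n, ⨆ _ : j ≤ i,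
      (G i).map (formalDeriv k m j)

/-- The differential module `M = D^m / D Φ` defined by the system. -/
abbrev Mod : Type _ :=
  (Fin m → Op k n) ⧸ Submodule.span (Op k n) (S.eqns : Set (Fin m → Op k n))

/-- The residue of the unknown `y^a` in `M`. -/
def gen (a : Fin m) : S.Mod := Submodule.Quotient.mk (Pi.single a 1)

/-- The codimension `cd(M)`, for the filtration of `M` induced by the order of the jets. -/
def cd : ℕ∞ := codim k n S.gen

/-- The module over `D' = k[d_1, ..., d_p]` defined by the equations of class `1, ..., p`. -/
abbrev SubMod (p : ℕ) : Type _ :=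
  (Fin m → SubOp k n p) ⧸ Submodule.span (SubOp k n p)
    {v : Fin m → SubOp k n p | (fun a => (v a : Op k n)) ∈ S.eqnsUpTo p}

instance (p : ℕ) : Module (SubOp k n p) (S.SubMod p) := Submodule.Quotient.module _

/-- The module over the whole ring `D` defined by the equations of class `1, ..., p`. -/
abbrev FullSubMod (p : ℕ) : Type _ :=
  (Fin m → Op k n) ⧸ Submodule.span (Op k n) (S.eqnsUpTo p : Set (Fin m → Op k n))

/-- The canonical `D'`-linear map from the module of the equations of class `1, ..., p` over
`D' = k[d_1, ..., d_p]` to `M`, which sends the residue of each unknown to its residue. -/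
def specialize (p : ℕ) : S.SubMod p →ₗ[SubOp k n p] S.Mod :=
  Submodule.liftQ _
    ((Submodule.mkQ (Submodule.span (Op k n)
        (S.eqns : Set (Fin m → Op k n)))).restrictScalars (SubOp k n p) ∘ₗ
      LinearMap.compLeft (Algebra.linearMap (SubOp k n p) (Op k n)) (Fin m))
    (Submodule.span_le.mpr fun _ hv =>
      (Submodule.Quotient.mk_eq_zero _).mpr (Submodule.subset_span hv.1))

/-- The canonical `D`-linear map from the module over `D` of the equations of class
`1, ..., p` to `M`. -/
def fullSpecialize (p : ℕ) : S.FullSubMod p →ₗ[Op k n] S.Mod :=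
  Submodule.factor (Submodule.span_mono fun _ hv => hv.1)

end FirstOrderSystem

/-! ### The diagram -/

/-- Let `f : X → Y` be linear over a ring `A`, let `T ⊆ X` and `T' ⊆ Y` be submodules, and let
`F` be an `A`-algebra.  The diagram

    0 → T  → X → F ⊗ X
        ↓    ↓     ↓
    0 → T' → Y → F ⊗ Y
        ↓    ↓     ↓
        0    0     0

with the inclusions, the canonical maps `x ↦ 1 ⊗ x`, the map `f`, the map induced by `f` and
the map `id ⊗ f` is well defined (`f` maps `T` into `T'`), commutative and has exact rows and
columns. -/
def CommExactDiagram {A X Y : Type*} [CommRing A] [AddCommGroup X] [Module A X]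
    [AddCommGroup Y] [Module A Y] (F : Type*) [CommRing F] [Algebra A F]
    (T : Submodule A X) (T' : Submodule A Y) (f : X →ₗ[A] Y) : Prop :=
  ∃ t : T →ₗ[A] T',
    -- the two squares commute
    T'.subtype ∘ₗ t = f ∘ₗ T.subtype ∧
    TensorProduct.mk A F Y 1 ∘ₗ f = f.lTensor F ∘ₗ TensorProduct.mk A F X 1 ∧
    -- the rows are exact
    Function.Injective T.subtype ∧
    Function.Exact T.subtype (TensorProduct.mk A F X 1) ∧
    Function.Injective T'.subtype ∧
    Function.Exact T'.subtype (TensorProduct.mk A F Y 1) ∧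
    -- the columns are exact
    Function.Surjective t ∧ Function.Surjective f ∧ Function.Surjective (f.lTensor F)

end PureModules

end

noncomputable section

namespace PureModules

open MvPolynomial

/-! ### Symbols of products and determinants -/

section Symbols

variable {k : Type*} [Field k] {σ : Type*}

/-! Let p be the least number such that, in every class above p, the leading coefficients of the
equations fill k^m. The equations of those classes can be solved for the d_j y^a with j > p
(`solvedFrom_gen`), so M is generated by the y^a over k[d_1, ..., d_p]. The determinant trick then
makes the quotient of k[χ] by the characteristic ideal of any finite family in M integral over
k[χ_1, ..., χ_p]. Its dimension is p, unless a nonzero operator in d_1, ..., d_p kills the family,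
and then it is smaller (`charDim_eq`, `charDim_succ_le`). No such operator kills all the y^a
(`not_exists_smul_gen_eq_zero`), so cd(M) = n - p and p = n - r. Applied to single elements, the
same dichotomy says that t_r(M) is the torsion of M over D' (`mem_tSub_iff`).

Involution enters through a normal form: the consequences of the system, of every order, are spanned
by multiplicative prolongations (`mem_multProlong_of_mem_span`), whose leading coefficients cannot
cancel. Hence a consequence that involves only d_1, ..., d_p follows from the equations of class at
most p, and M_r → M is injective (`specialize_injective`). Being solved makes it surjective. So M_r
and M are isomorphic over D', and the first diagram reduces to the fact that torsion is the kernel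
of localization.

The module over D is the extension of M_r along D' → D. As D is free over D', denominators can be
cleared coordinate by coordinate, so its torsion over D and over D' agree
(`exists_algebraMap_smul_mem_span`); preimages of elements of M are taken from M_r. -/

theorem homogeneousComponent_mem_supported {s : Set σ} {f : MvPolynomial σ k}
    (hf : f ∈ supported k s) (q : ℕ) : homogeneousComponent q f ∈ supported k s := by
  classical
  rw [mem_supported] at hf ⊢
  refine subset_trans (fun i hi => ?_) hf
  rw [Finset.mem_coe, mem_vars_iff_mem_support] at hi ⊢
  obtain ⟨d, hd, hid⟩ := hi
  rw [support_homogeneousComponent] at hd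
  exact ⟨d, (Finset.mem_filter.mp hd).1, hid⟩

theorem exists_homogeneousComponent_ne_zero {f : MvPolynomial σ k} (hf : f ≠ 0) :
    homogeneousComponent f.totalDegree f ≠ 0 := by
  intro h
  obtain ⟨d, hd, hdeg⟩ := Finset.exists_mem_eq_sup f.support (support_nonempty.mpr hf)
    (fun s => s.sum fun _ e => e)
  have := congrArg (coeff d) h
  rw [coeff_homogeneousComponent, if_pos (by rw [totalDegree, hdeg]; rfl), coeff_zero] at this
  exact mem_support_iff.mp hd this

theorem homogeneousComponent_homogeneousComponent (f : MvPolynomial σ k) (q : ℕ) :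
    homogeneousComponent q (homogeneousComponent q f) = homogeneousComponent q f := by
  ext d
  simp only [coeff_homogeneousComponent]
  split_ifs <;> rfl

theorem totalDegree_homogeneousComponent_le (f : MvPolynomial σ k) (q : ℕ) :
    (homogeneousComponent q f).totalDegree ≤ q :=
  (homogeneousComponent_isHomogeneous q f).totalDegree_le

theorem totalDegree_le_of_homogeneousComponent_succ_eq_zero {f : MvPolynomial σ k} {q : ℕ}
    (hf : f.totalDegree ≤ q + 1) (h : homogeneousComponent (q + 1) f = 0) :
    f.totalDegree ≤ q := by
  by_contra! hlt
  have hq : f.totalDegree = q + 1 := by omega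
  have hf0 : f ≠ 0 := by
    rintro rfl
    simp at hq
  exact exists_homogeneousComponent_ne_zero hf0 (hq ▸ h)

theorem homogeneousComponent_X_mul (j : σ) (f : MvPolynomial σ k) (q : ℕ) :
    homogeneousComponent (q + 1) (X j * f) = X j * homogeneousComponent q f := by
  classical
  ext d
  rw [coeff_homogeneousComponent, coeff_X_mul', coeff_X_mul', coeff_homogeneousComponent]
  split_ifs with h1 h2 h3 h3 h2 <;> try rfl
  · exfalso
    apply h3
    have : d = (d - Finsupp.single j 1) + Finsupp.single j 1 := by
      rw [tsub_add_cancel_of_le]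
      rw [Finsupp.single_le_iff]
      exact Nat.one_le_iff_ne_zero.mpr (Finsupp.mem_support_iff.mp h2)
    rw [this, map_add, Finsupp.degree_single] at h1
    omega
  · exfalso
    apply h1
    have : d = (d - Finsupp.single j 1) + Finsupp.single j 1 := by
      rw [tsub_add_cancel_of_le]
      rw [Finsupp.single_le_iff]
      exact Nat.one_le_iff_ne_zero.mpr (Finsupp.mem_support_iff.mp ‹_›)
    rw [this, map_add, Finsupp.degree_single, h2]

theorem homogeneousComponent_zero_X_mul (j : σ) (f : MvPolynomial σ k) :
    homogeneousComponent 0 (X j * f) = 0 := by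
  classical
  rw [homogeneousComponent_zero, coeff_X_mul', if_neg (by simp), C_0]

theorem totalDegree_prod_le_card_mul {ι : Type*} (s : Finset ι) (f : ι → MvPolynomial σ k) {q : ℕ}
    (hf : ∀ i ∈ s, (f i).totalDegree ≤ q) : (∏ i ∈ s, f i).totalDegree ≤ s.card * q :=
  (totalDegree_finsetProd s f).trans ((Finset.sum_le_card_nsmul _ _ _ hf).trans_eq (by simp))

theorem homogeneousComponent_prod {ι : Type*} (s : Finset ι) (f : ι → MvPolynomial σ k) {q : ℕ}
    (hf : ∀ i ∈ s, (f i).totalDegree ≤ q) :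
    homogeneousComponent (s.card * q) (∏ i ∈ s, f i) = ∏ i ∈ s, homogeneousComponent q (f i) := by
  classical
  induction s using Finset.induction_on with
  | empty => simp [homogeneousComponent_zero]
  | insert a s ha ih =>
    have hs : ∀ i ∈ s, (f i).totalDegree ≤ q := fun i hi => hf i (Finset.mem_insert_of_mem hi)
    rw [Finset.prod_insert ha, Finset.prod_insert ha, Finset.card_insert_of_notMem ha, ← ih hs,
      ← homogeneousComponent_mul_of_le k (hf a (Finset.mem_insert_self _ _))
        (totalDegree_prod_le_card_mul s f hs)]
    congr 2
    ring

variable {ι : Type*} [Fintype ι] [DecidableEq ι]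

theorem totalDegree_det_le {A : Matrix ι ι (MvPolynomial σ k)} {q : ℕ}
    (hA : ∀ i j, (A i j).totalDegree ≤ q) : A.det.totalDegree ≤ Fintype.card ι * q := by
  rw [Matrix.det_apply]
  refine totalDegree_finsetSum_le fun τ _ => (totalDegree_smul_le _ _).trans ?_
  exact totalDegree_prod_le_card_mul _ _ fun i _ => hA _ _

theorem homogeneousComponent_det {A : Matrix ι ι (MvPolynomial σ k)} {q : ℕ}
    (hA : ∀ i j, (A i j).totalDegree ≤ q) :
    homogeneousComponent (Fintype.card ι * q) A.det = (A.map (homogeneousComponent q)).det := by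
  rw [Matrix.det_apply', Matrix.det_apply', map_sum]
  refine Finset.sum_congr rfl fun τ _ => ?_
  have := homogeneousComponent_prod Finset.univ (fun i => A (τ i) i) (q := q) fun i _ => hA _ _
  rcases Int.units_eq_one_or (Equiv.Perm.sign τ) with h | h <;>
    simpa [h] using this

theorem det_mem_subalgebra {R S : Type*} [CommRing R] [CommRing S] [Algebra R S]
    (B : Subalgebra R S) {A : Matrix ι ι S} (hA : ∀ i j, A i j ∈ B) : A.det ∈ B := by
  rw [Matrix.det_apply']
  exact sum_mem fun τ _ => mul_mem (intCast_mem _ _) (prod_mem fun i _ => hA _ _)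

/-- Multiply the relations by the adjugate. This determinant trick produces all the annihilating
operators below. -/
theorem det_smul_eq_zero {R N : Type*} [CommRing R] [AddCommGroup N] [Module R N]
    {A : Matrix ι ι R} {y : ι → N} (h : ∀ a, ∑ b, A a b • y b = 0) (c : ι) : A.det • y c = 0 := by
  have h1 : ∑ b, (A.adjugate * A) c b • y b = 0 := by
    simp only [Matrix.mul_apply, Finset.sum_smul, mul_smul]
    rw [Finset.sum_comm]
    refine Finset.sum_eq_zero fun a _ => ?_
    rw [← Finset.smul_sum, h, smul_zero]
  simpa [Matrix.adjugate_mul, Matrix.smul_apply, Matrix.one_apply, ite_smul] using h1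

end Symbols

/-! ### Modules solved for the derivatives beyond the first `p` -/

section Generators

variable {k : Type*} [Field k] {n : ℕ} {ι : Type*} [Fintype ι]
  {N : Type*} [AddCommGroup N] [Module (Op k n) N]

/-- Every element of the symbol module has the symbols of relations as homogeneous parts. -/
theorem exists_relation_of_mem_symbolModule {g : ι → N} {w : ι → Op k n}
    (hw : w ∈ symbolModule k n g) (q : ℕ) :
    ∃ v : ι → Op k n, ∑ a, v a • g a = 0 ∧ (∀ a, (v a).totalDegree ≤ q) ∧
      ∀ a, homogeneousComponent q (v a) = homogeneousComponent q (w a) := by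
  induction hw using Submodule.span_induction generalizing q with
  | mem w hw =>
    obtain ⟨e, v, hv, he, rfl⟩ := hw
    by_cases h : q = e
    · subst h
      exact ⟨v, hv, he, fun a => (homogeneousComponent_homogeneousComponent _ _).symm⟩
    -- The generator is homogeneous of degree `e`, so its other components are symbols of the zero
    -- relation.
    · refine ⟨0, by simp, by simp, fun a => ?_⟩
      rw [homogeneousComponent_of_mem (homogeneousComponent_mem e (v a)), if_neg h]
      simp
  | zero => exact ⟨0, by simp, by simp, by simp⟩
  | add x y _ _ hx hy =>
    obtain ⟨v, hv, hvq, hvx⟩ := hx q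
    obtain ⟨u, hu, huq, huy⟩ := hy q
    refine ⟨v + u, ?_, fun a => (totalDegree_add _ _).trans (max_le (hvq a) (huq a)),
      fun a => by simp [hvx, huy]⟩
    simp [add_smul, Finset.sum_add_distrib, hv, hu]
  | smul c x _ hx =>
    -- Multiplication by a variable shifts the degree by one, so the inductive hypothesis on the
    -- scalar must be available for every `q`.
    induction c using MvPolynomial.induction_on generalizing q with
    | C c =>
      obtain ⟨v, hv, hvq, hvx⟩ := hx q
      refine ⟨fun a => C c * v a, ?_, fun a => ?_, fun a => ?_⟩
      · simp only [mul_smul]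
        rw [← Finset.smul_sum, hv, smul_zero]
      · refine (totalDegree_mul _ _).trans ?_
        simpa using hvq a
      · simp [homogeneousComponent_C_mul, hvx]
    | add c d hc hd =>
      obtain ⟨v, hv, hvq, hvx⟩ := hc q
      obtain ⟨u, hu, huq, huy⟩ := hd q
      refine ⟨v + u, ?_, fun a => (totalDegree_add _ _).trans (max_le (hvq a) (huq a)),
        fun a => by simp [hvx, huy, add_mul]⟩
      simp [add_smul, Finset.sum_add_distrib, hv, hu]
    | mul_X c j hc =>
      have hcx : ∀ a, ((c * X j : Op k n) • x) a = X j * (c • x) a := fun a => by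
        simp only [Pi.smul_apply, smul_eq_mul]
        ring
      cases q with
      | zero =>
        refine ⟨0, by simp, by simp, fun a => ?_⟩
        rw [hcx, homogeneousComponent_zero_X_mul]
        simp
      | succ q =>
        obtain ⟨v, hv, hvq, hvx⟩ := hc q
        refine ⟨fun a => X j * v a, ?_, fun a => ?_, fun a => ?_⟩
        · simp only [mul_smul]
          rw [← Finset.smul_sum, hv, smul_zero]
        · refine (totalDegree_mul _ _).trans ?_
          rw [totalDegree_X, add_comm]
          exact Nat.add_le_add_right (hvq a) 1
        · rw [hcx, homogeneousComponent_X_mul, homogeneousComponent_X_mul, hvx]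

theorem mem_annihilator_symbolModule [DecidableEq ι] {g : ι → N} {f : Op k n} :
    f ∈ Module.annihilator (Op k n) ((ι → Op k n) ⧸ symbolModule k n g) ↔
      ∀ a, Pi.single a f ∈ symbolModule k n g := by
  rw [Submodule.annihilator_quotient, Submodule.mem_colon]
  constructor
  · intro h a
    simpa [← Pi.single_smul'] using h (Pi.single a 1) trivial
  · intro h v _
    have : f • v = ∑ a, v a • (Pi.single a f : ι → Op k n) := by
      funext b
      simp [Finset.sum_apply, Pi.single_apply, mul_comm]
    rw [this]
    exact Submodule.sum_mem _ fun a _ => Submodule.smul_mem _ _ (h a)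

theorem homogeneousComponent_mem_annihilator {g : ι → N} {u : Op k n} {q : ℕ}
    (hq : u.totalDegree ≤ q) (hu : ∀ a, u • g a = 0) :
    homogeneousComponent q u ∈
      Module.annihilator (Op k n) ((ι → Op k n) ⧸ symbolModule k n g) := by
  classical
  rw [mem_annihilator_symbolModule]
  intro a
  refine Submodule.subset_span ⟨q, Pi.single a u, ?_, fun b => ?_, ?_⟩
  · simp [Pi.single_apply, ite_smul, hu]
  · by_cases h : b = a
    · subst h
      simpa using hq
    · simp [Pi.single_eq_of_ne h]
  · funext b
    by_cases h : b = a
    · subst h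
      simp
    · simp [Pi.single_eq_of_ne h]

/-- A nonzero operator of the subring that annihilates the associated graded module gives an
operator that annihilates the module and whose symbol lies in the subring. -/
theorem exists_operator_of_mem_annihilator_symbol {g : ι → N} {f : Op k n} {p : ℕ}
    (hf : f ∈ Module.annihilator (Op k n) ((ι → Op k n) ⧸ symbolModule k n g)) (hf0 : f ≠ 0)
    (hfp : f ∈ SubOp k n p) :
    ∃ (q : ℕ) (u : Op k n), u.totalDegree ≤ q ∧ (∀ a, u • g a = 0) ∧
      homogeneousComponent q u ≠ 0 ∧ homogeneousComponent q u ∈ SubOp k n p := by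
  classical
  rw [mem_annihilator_symbolModule] at hf
  -- For each `a`, the vector with sole entry `f` at `a` has the symbol of a relation `v a` as its
  -- top part. These relations form a square matrix whose symbol is scalar, so its determinant kills
  -- the family and has a power of the symbol of `f` as its symbol.
  choose v hv hvq hvf using fun a => exists_relation_of_mem_symbolModule (hf a) f.totalDegree
  set e := f.totalDegree
  have hA : ∀ a b, ((Matrix.of v) a b).totalDegree ≤ e := fun a b => hvq a b
  have key : homogeneousComponent (Fintype.card ι * e) (Matrix.of v).det =
      homogeneousComponent e f ^ Fintype.card ι := by
    rw [homogeneousComponent_det hA]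
    have : (Matrix.of v).map (homogeneousComponent e) =
        Matrix.diagonal fun _ => homogeneousComponent e f := by
      ext a b : 1
      rw [Matrix.map_apply, Matrix.of_apply, hvf, Matrix.diagonal_apply]
      by_cases h : a = b
      · subst h
        simp
      · simp [h]
    rw [this]
    simp
  refine ⟨_, (Matrix.of v).det, totalDegree_det_le hA, det_smul_eq_zero hv, ?_, ?_⟩
  · rw [key]
    exact pow_ne_zero _ (exists_homogeneousComponent_ne_zero hf0)
  · rw [key]
    exact pow_mem (homogeneousComponent_mem_supported hfp _) _

variable (k n) in
/-- The derivatives of the elements of the family with respect to the variables from `p` on are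
combinations of the elements with coefficients of order `≤ 1` in the first `p` derivations. -/
def SolvedFrom (p : ℕ) (y : ι → N) : Prop :=
  ∀ j : Fin n, p ≤ (j : ℕ) → ∀ a, ∃ w : ι → Op k n,
    (∀ b, w b ∈ SubOp k n p) ∧ (∀ b, (w b).totalDegree ≤ 1) ∧
      (X j : Op k n) • y a = ∑ b, w b • y b

variable (k n) in
/-- The combinations of the family with coefficients of order `≤ e` in the first `p`
derivations. -/
def combosLE (p : ℕ) (y : ι → N) (e : ℕ) : AddSubmonoid N where
  carrier := {z | ∃ w : ι → Op k n, (∀ b, w b ∈ SubOp k n p) ∧ (∀ b, (w b).totalDegree ≤ e) ∧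
      z = ∑ b, w b • y b}
  zero_mem' := ⟨0, fun _ => zero_mem _, by simp, by simp⟩
  add_mem' := by
    rintro _ _ ⟨v, hv, hve, rfl⟩ ⟨u, hu, hue, rfl⟩
    exact ⟨v + u, fun b => add_mem (hv b) (hu b),
      fun b => (totalDegree_add _ _).trans (max_le (hve b) (hue b)), by
        simp [add_smul, Finset.sum_add_distrib]⟩

theorem combosLE_mono {p : ℕ} {y : ι → N} {d e : ℕ} (h : d ≤ e) :
    combosLE k n p y d ≤ combosLE k n p y e := by
  rintro _ ⟨w, hw, hwe, rfl⟩
  exact ⟨w, hw, fun b => (hwe b).trans h, rfl⟩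

theorem smul_mem_combosLE {p : ℕ} {y : ι → N} {d e : ℕ} {f : Op k n} {z : N}
    (hf : f ∈ SubOp k n p) (hfd : f.totalDegree ≤ d) (hz : z ∈ combosLE k n p y e) :
    f • z ∈ combosLE k n p y (d + e) := by
  obtain ⟨w, hw, hwe, rfl⟩ := hz
  refine ⟨fun b => f * w b, fun b => mul_mem hf (hw b),
    fun b => (totalDegree_mul _ _).trans (add_le_add hfd (hwe b)), ?_⟩
  simp [Finset.smul_sum, mul_smul]

theorem X_smul_mem_combosLE {p : ℕ} {y : ι → N} (hy : SolvedFrom k n p y) {e : ℕ} {z : N}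
    (hz : z ∈ combosLE k n p y e) (j : Fin n) :
    (X j : Op k n) • z ∈ combosLE k n p y (e + 1) := by
  by_cases hj : (j : ℕ) < p
  · rw [add_comm]
    exact smul_mem_combosLE (X_mem_supported.mpr hj) (totalDegree_X _).le hz
  · obtain ⟨w, hw, hwe, rfl⟩ := hz
    rw [Finset.smul_sum]
    refine sum_mem fun b _ => ?_
    rw [smul_comm]
    exact smul_mem_combosLE (hw b) (hwe b) (hy j (not_lt.mp hj) b)

/-- Strip the variables of a monomial one at a time. A derivation beyond the first `p` is rewritten
by an operator of order at most one, so no rewriting raises the order above that of the monomial. -/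
theorem smul_mem_combosLE_of_solvedFrom {p : ℕ} {y : ι → N} (hy : SolvedFrom k n p y) {e : ℕ}
    {f : Op k n} (hf : f.totalDegree ≤ e) (a : ι) : f • y a ∈ combosLE k n p y e := by
  classical
  have hmon : ∀ (q : ℕ) (d : Fin n →₀ ℕ), d.degree = q → ∀ c : k,
      (monomial d c) • y a ∈ combosLE k n p y q := by
    intro q
    induction q with
    | zero =>
      intro d hd c
      rw [(Finsupp.degree_eq_zero_iff d).mp hd]
      refine ⟨Pi.single a (C c), fun b => ?_, fun b => ?_, ?_⟩
      · by_cases h : b = a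
        · subst h
          rw [Pi.single_eq_same]
          exact Subalgebra.algebraMap_mem _ c
        · rw [Pi.single_eq_of_ne h]
          exact zero_mem _
      · by_cases h : b = a
        · subst h
          simp
        · simp [Pi.single_eq_of_ne h]
      · simp [Pi.single_apply, ite_smul, monomial_zero']
    | succ q ih =>
      intro d hd c
      obtain ⟨j, hj⟩ : ∃ j, d j ≠ 0 := by
        by_contra! h
        rw [show d = 0 from Finsupp.ext h] at hd
        simp at hd
      have hle : Finsupp.single j 1 ≤ d := by
        rw [Finsupp.single_le_iff]
        exact Nat.one_le_iff_ne_zero.mpr hj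
      obtain ⟨d', rfl⟩ := exists_add_of_le hle
      have : d'.degree = q := by
        rw [map_add, Finsupp.degree_single] at hd
        omega
      have hX : (monomial (Finsupp.single j 1 + d') c : Op k n) = X j * monomial d' c := by
        rw [X, monomial_mul, one_mul]
      rw [hX, mul_smul]
      exact X_smul_mem_combosLE hy (ih d' this c) j
  rw [← support_sum_monomial_coeff f, Finset.sum_smul]
  exact sum_mem fun d hd => combosLE_mono ((le_totalDegree hd).trans hf) (hmon _ d rfl _)

/-- The matrix by which an operator of order `≤ e` acts on the family. -/
theorem exists_matrix_of_solvedFrom {p : ℕ} {y : ι → N} (hy : SolvedFrom k n p y) {e : ℕ}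
    {f : Op k n} (hf : f.totalDegree ≤ e) :
    ∃ W : Matrix ι ι (Op k n), (∀ a b, W a b ∈ SubOp k n p) ∧
      (∀ a b, (W a b).totalDegree ≤ e) ∧ ∀ a, f • y a = ∑ b, W a b • y b := by
  choose W h1 h2 h3 using fun a => smul_mem_combosLE_of_solvedFrom hy hf a
  exact ⟨Matrix.of W, h1, h2, h3⟩

theorem smul_eq_zero_of_span_eq_top {ι : Type*} {y : ι → N}
    (hspan : Submodule.span (Op k n) (Set.range y) = ⊤) {f : Op k n} (h : ∀ a, f • y a = 0)
    (z : N) : f • z = 0 := by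
  have hz : z ∈ Submodule.span (Op k n) (Set.range y) := hspan ▸ Submodule.mem_top
  induction hz using Submodule.span_induction with
  | mem x hx =>
    obtain ⟨a, rfl⟩ := hx
    exact h a
  | zero => simp
  | add x y _ _ hx hy => rw [smul_add, hx, hy, add_zero]
  | smul c x _ hx => rw [smul_comm, hx, smul_zero]

theorem det_scalar_sub_smul_eq_zero [DecidableEq ι] {y : ι → N}
    (hspan : Submodule.span (Op k n) (Set.range y) = ⊤)
    {W : Matrix ι ι (Op k n)} {f : Op k n} (h : ∀ a, f • y a = ∑ b, W a b • y b) (z : N) :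
    (Matrix.scalar ι f - W).det • z = 0 := by
  refine smul_eq_zero_of_span_eq_top hspan (det_smul_eq_zero fun a => ?_) z
  simp [sub_smul, Matrix.diagonal_apply, ite_smul, h]

/-- If the symbol of an operator lies in the subring, then what the operator annihilates is
annihilated by an operator of the subring. -/
theorem exists_mem_subOp_of_symbol_mem {p : ℕ} {y : ι → N} (hy : SolvedFrom k n p y)
    (hspan : Submodule.span (Op k n) (Set.range y) = ⊤) {q : ℕ} {u : Op k n}
    (hu : u.totalDegree ≤ q) (hu0 : homogeneousComponent q u ≠ 0)
    (hup : homogeneousComponent q u ∈ SubOp k n p) :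
    ∃ f ∈ SubOp k n p, f ≠ 0 ∧ ∀ z : N, u • z = 0 → f • z = 0 := by
  classical
  -- In order zero `u` is a constant and needs no elimination; below, the order of the remainder is
  -- the predecessor of that of `u`.
  cases q with
  | zero =>
    have : u = homogeneousComponent 0 u := by
      rw [homogeneousComponent_zero]
      exact totalDegree_eq_zero_iff_eq_C.mp (by omega)
    rw [← this] at hu0 hup
    exact ⟨u, hup, hu0, fun _ h => h⟩
  | succ q =>
    set f := homogeneousComponent (q + 1) u with hf
    have hfu : homogeneousComponent (q + 1) f = f := homogeneousComponent_homogeneousComponent _ _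
    have hfd : f.totalDegree ≤ q + 1 := totalDegree_homogeneousComponent_le _ _
    -- The difference of `u` and its symbol has lower order, so it acts on the family by a matrix
    -- `W` over the subring, of order lower than that of `f`. The operator sought is the
    -- characteristic polynomial of `W` at `f`: its symbol is a power of `f`.
    have hw : (f - u).totalDegree ≤ q := by
      refine totalDegree_le_of_homogeneousComponent_succ_eq_zero
        ((totalDegree_sub _ _).trans (max_le hfd hu)) ?_
      rw [map_sub, hfu, sub_self]
    obtain ⟨W, hWp, hWq, hW⟩ := exists_matrix_of_solvedFrom hy hw
    refine ⟨(Matrix.scalar ι f - W).det, ?_, ?_, fun z hz => ?_⟩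
    · refine det_mem_subalgebra _ fun a b => ?_
      rw [Matrix.sub_apply]
      refine sub_mem ?_ (hWp a b)
      rw [Matrix.scalar_apply, Matrix.diagonal_apply]
      split_ifs
      exacts [hup, zero_mem _]
    · have hdeg : ∀ a b, ((Matrix.scalar ι f - W) a b).totalDegree ≤ q + 1 := by
        intro a b
        rw [Matrix.sub_apply]
        refine (totalDegree_sub _ _).trans (max_le ?_ ((hWq a b).trans (Nat.le_succ q)))
        rw [Matrix.scalar_apply, Matrix.diagonal_apply]
        split_ifs
        · exact hfd
        · simp
      intro h0
      have h1 := homogeneousComponent_det hdeg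
      have h2 : (Matrix.scalar ι f - W).map (homogeneousComponent (q + 1)) =
          Matrix.diagonal fun _ => f := by
        ext a b : 1
        rw [Matrix.map_apply, Matrix.sub_apply, map_sub,
          homogeneousComponent_eq_zero _ _ (Nat.lt_succ_of_le (hWq a b)), sub_zero,
          Matrix.scalar_apply, Matrix.diagonal_apply]
        split_ifs
        · rw [hfu]
        · simp
      rw [h0, h2, map_zero, Matrix.det_diagonal, Finset.prod_const] at h1
      exact pow_ne_zero _ hu0 h1.symm
    · have h1 := det_scalar_sub_smul_eq_zero hspan hW z
      -- The characteristic polynomial kills everything at `f - u` by the determinant trick. Its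
      -- values at `f` and at `f - u` differ by a multiple of `u`, which kills `z`.
      rw [← Matrix.eval_charpoly] at h1 ⊢
      obtain ⟨c, hc⟩ := Polynomial.sub_dvd_eval_sub f (f - u) W.charpoly
      rw [sub_eq_iff_eq_add.mp hc, add_smul, h1, add_zero, mul_comm, mul_smul, sub_sub_cancel, hz,
        smul_zero]

/-- The associated graded module of any family is finite over the subring. -/
theorem isIntegral_quotient_charIdeal {κ : Type*} [Fintype κ] {p : ℕ} {y : ι → N}
    (hy : SolvedFrom k n p y) (hspan : Submodule.span (Op k n) (Set.range y) = ⊤) (g : κ → N) :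
    Algebra.IsIntegral (SubOp k n p) (Op k n ⧸ charIdeal k n g) := by
  classical
  have hX : ∀ j : Fin n,
      IsIntegral (SubOp k n p) (Ideal.Quotient.mk (charIdeal k n g) (X j)) := by
    intro j
    by_cases hj : (j : ℕ) < p
    · exact isIntegral_algebraMap (A := Op k n ⧸ charIdeal k n g)
        (x := (⟨X j, X_mem_supported.mpr hj⟩ : SubOp k n p))
    obtain ⟨W, hWp, hWq, hW⟩ := exists_matrix_of_solvedFrom hy (totalDegree_X j).le
    -- The first order part of the matrix by which the derivation acts. Its characteristic
    -- polynomial is the integral equation: evaluated at the variable, it is the symbol of an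
    -- operator that kills the whole module.
    let W1 : Matrix ι ι (SubOp k n p) := Matrix.of fun a b =>
      ⟨homogeneousComponent 1 (W a b), homogeneousComponent_mem_supported (hWp a b) 1⟩
    refine ⟨W1.charpoly, W1.charpoly_monic, ?_⟩
    have hdeg : ∀ a b, ((Matrix.scalar ι (X j : Op k n) - W) a b).totalDegree ≤ 1 := by
      intro a b
      rw [Matrix.sub_apply]
      refine (totalDegree_sub _ _).trans (max_le ?_ (hWq a b))
      rw [Matrix.scalar_apply, Matrix.diagonal_apply]
      split_ifs
      · exact (totalDegree_X j).le
      · simp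
    have h1 := homogeneousComponent_mem_annihilator (g := g) (totalDegree_det_le hdeg)
      fun a => det_scalar_sub_smul_eq_zero hspan hW (g a)
    rw [homogeneousComponent_det hdeg] at h1
    have h2 : (Matrix.scalar ι (X j : Op k n) - W).map (homogeneousComponent 1) =
        Matrix.scalar ι (X j) - W1.map (algebraMap (SubOp k n p) (Op k n)) := by
      ext a b : 1
      rw [Matrix.map_apply, Matrix.sub_apply, Matrix.sub_apply, map_sub, Matrix.map_apply]
      have h4 : algebraMap (SubOp k n p) (Op k n) (W1 a b) = homogeneousComponent 1 (W a b) := rfl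
      rw [h4, sub_left_inj, Matrix.scalar_apply, Matrix.diagonal_apply]
      split_ifs
      · exact homogeneousComponent_eq_self (isHomogeneous_X k j)
      · simp
    rw [h2, ← Matrix.eval_charpoly, Matrix.charpoly_map, Polynomial.eval_map] at h1
    have h3 : (Ideal.Quotient.mk (charIdeal k n g))
        (W1.charpoly.eval₂ (algebraMap (SubOp k n p) (Op k n)) (X j)) = 0 :=
      Ideal.Quotient.eq_zero_iff_mem.mpr (Ideal.le_radical h1)
    rw [Polynomial.hom_eval₂] at h3
    exact h3
  refine ⟨fun x => ?_⟩
  obtain ⟨f, rfl⟩ := Ideal.Quotient.mk_surjective x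
  induction f using MvPolynomial.induction_on with
  | C c =>
    exact isIntegral_algebraMap (A := Op k n ⧸ charIdeal k n g)
      (x := algebraMap k (SubOp k n p) c)
  | add f g hf hg => rw [map_add]; exact hf.add hg
  | mul_X f j hf => rw [map_mul]; exact hf.mul (hX j)

end Generators

/-! ### Krull dimension along integral extensions -/

section Dimension

theorem ringKrullDim_le_of_isIntegral (R S : Type*) [CommRing R] [CommRing S] [Algebra R S]
    [Algebra.IsIntegral R S] : ringKrullDim S ≤ ringKrullDim R :=
  Order.krullDim_le_of_strictMono (PrimeSpectrum.comap (algebraMap R S)) fun I J h =>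
    Ideal.IsIntegral.comap_lt_comap (I := I.asIdeal) (J := J.asIdeal) h

theorem ringKrullDim_le_of_isIntegral_of_injective (R S : Type*) [CommRing R] [CommRing S]
    [Algebra R S] [Algebra.IsIntegral R S] (h : Function.Injective (algebraMap R S)) :
    ringKrullDim R ≤ ringKrullDim S := by
  refine iSup_le fun l => ?_
  -- Injectivity gives a prime over the bottom of the chain; going up lifts the rest.
  obtain ⟨P, -, hP, hPl⟩ := Ideal.exists_ideal_over_prime_of_isIntegral (S := S) l.head.asIdeal ⊥
    (by rw [← RingHom.ker_eq_comap_bot, (RingHom.injective_iff_ker_eq_bot _).mp h]; exact bot_le)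
  have : P.LiesOver l.head.asIdeal := ⟨hPl.symm⟩
  obtain ⟨L, hL, -⟩ := Ideal.exists_ltSeries_of_hasGoingUp l P
  rw [← hL]
  exact Order.LTSeries.length_le_krullDim L

theorem ringKrullDim_succ_le_of_isIntegral_of_map_eq_zero (R S : Type*) [CommRing R] [IsDomain R]
    [CommRing S] [Algebra R S] [Algebra.IsIntegral R S] {f : R} (hf : f ≠ 0)
    (h : algebraMap R S f = 0) : ringKrullDim S + 1 ≤ ringKrullDim R := by
  have hint : Algebra.IsIntegral (Algebra.ofId R S).range S :=
    ⟨fun x => (Algebra.IsIntegral.isIntegral (R := R) x).tower_top⟩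
  refine le_trans (add_le_add_left (ringKrullDim_le_of_isIntegral (Algebra.ofId R S).range S) 1) ?_
  -- The image of the domain `R` in `S` is a quotient by an ideal containing `f ≠ 0`, so it has
  -- smaller dimension, and `S` is integral over it.
  refine ringKrullDim_succ_le_of_surjective (Algebra.ofId R S).rangeRestrict.toRingHom
    (Algebra.ofId R S).rangeRestrict_surjective (mem_nonZeroDivisors_of_ne_zero hf) ?_
  exact Subtype.ext h

variable (k : Type*) [Field k] {n p : ℕ}

theorem ringKrullDim_subOp (hp : p ≤ n) : ringKrullDim (SubOp k n p) = p := by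
  rw [ringKrullDim_eq_of_ringEquiv (supportedEquivMvPolynomial _).toRingEquiv,
    MvPolynomial.ringKrullDim_of_isNoetherianRing, ringKrullDim_eq_zero_of_field, zero_add]
  have e : {j : Fin n | (j : ℕ) < p} ≃ Fin p :=
    { toFun := fun j => ⟨j.1, j.2⟩
      invFun := fun j => ⟨⟨j, j.2.trans_le hp⟩, j.2⟩
      left_inv := fun _ => rfl
      right_inv := fun _ => rfl }
  rw [Nat.card_congr e, Nat.card_fin]

end Dimension

/-! ### Codimension in terms of annihilating operators in the first `p` derivations -/

section Codimension

variable {k : Type*} [Field k] {n p : ℕ} {ι κ : Type*} [Fintype ι] [Fintype κ]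
  {N : Type*} [AddCommGroup N] [Module (Op k n) N] {y : ι → N}

/-- A symbol in the subring that kills the graded module lifts to an annihilating operator that may
involve all derivations; elimination then brings that operator into the subring. In the other
direction, take the symbol. -/
theorem exists_mem_charIdeal_iff (hy : SolvedFrom k n p y)
    (hspan : Submodule.span (Op k n) (Set.range y) = ⊤) (g : κ → N) :
    (∃ f ∈ SubOp k n p, f ≠ 0 ∧ f ∈ charIdeal k n g) ↔
      ∃ f ∈ SubOp k n p, f ≠ 0 ∧ ∀ a, f • g a = 0 := by
  constructor
  · rintro ⟨f, hfp, hf0, e, hf⟩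
    obtain ⟨q, u, huq, hug, hu0, hup⟩ :=
      exists_operator_of_mem_annihilator_symbol hf (pow_ne_zero e hf0) (pow_mem hfp e)
    obtain ⟨f', h1, h2, h3⟩ := exists_mem_subOp_of_symbol_mem hy hspan huq hu0 hup
    exact ⟨f', h1, h2, fun a => h3 _ (hug a)⟩
  · rintro ⟨f, hfp, hf0, hf⟩
    exact ⟨_, homogeneousComponent_mem_supported hfp _, exists_homogeneousComponent_ne_zero hf0,
      Ideal.le_radical (homogeneousComponent_mem_annihilator le_rfl hf)⟩

theorem charDim_le (hp : p ≤ n) (hy : SolvedFrom k n p y)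
    (hspan : Submodule.span (Op k n) (Set.range y) = ⊤) (g : κ → N) :
    charDim k n g ≤ p := by
  have := isIntegral_quotient_charIdeal hy hspan g
  rw [← ringKrullDim_subOp k hp]
  exact ringKrullDim_le_of_isIntegral _ _

theorem charDim_succ_le (hp : p ≤ n) (hy : SolvedFrom k n p y)
    (hspan : Submodule.span (Op k n) (Set.range y) = ⊤) {g : κ → N}
    (h : ∃ f ∈ SubOp k n p, f ≠ 0 ∧ ∀ a, f • g a = 0) :
    charDim k n g + 1 ≤ p := by
  have := isIntegral_quotient_charIdeal hy hspan g
  obtain ⟨f, hfp, hf0, hf⟩ := (exists_mem_charIdeal_iff hy hspan g).mpr h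
  rw [← ringKrullDim_subOp k hp]
  exact ringKrullDim_succ_le_of_isIntegral_of_map_eq_zero (SubOp k n p) (Op k n ⧸ charIdeal k n g)
    (f := ⟨f, hfp⟩) (fun h0 => hf0 (congrArg Subtype.val h0)) (Ideal.Quotient.eq_zero_iff_mem.mpr hf)

theorem charDim_eq (hp : p ≤ n) (hy : SolvedFrom k n p y)
    (hspan : Submodule.span (Op k n) (Set.range y) = ⊤) {g : κ → N}
    (h : ¬ ∃ f ∈ SubOp k n p, f ≠ 0 ∧ ∀ a, f • g a = 0) : charDim k n g = p := by
  refine le_antisymm (charDim_le hp hy hspan g) ?_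
  have := isIntegral_quotient_charIdeal hy hspan g
  rw [← exists_mem_charIdeal_iff hy hspan g] at h
  rw [← ringKrullDim_subOp k hp]
  refine ringKrullDim_le_of_isIntegral_of_injective _ _ ?_
  rw [injective_iff_map_eq_zero]
  intro f hf
  by_contra hf0
  exact h ⟨f, f.2, fun h0 => hf0 (Subtype.ext h0), Ideal.Quotient.eq_zero_iff_mem.mp hf⟩

theorem codim_eq (hp : p ≤ n) (hy : SolvedFrom k n p y)
    (hspan : Submodule.span (Op k n) (Set.range y) = ⊤) {g : κ → N}
    (h : ¬ ∃ f ∈ SubOp k n p, f ≠ 0 ∧ ∀ a, f • g a = 0) : codim k n g = (n - p : ℕ) := by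
  rw [codim, charDim_eq hp hy hspan h, if_neg (by exact WithBot.coe_ne_bot)]
  exact (ENat.natCast_sub n p).symm

theorem lt_codim_of_charDim_succ_le {r : ℕ} (hp : p + r ≤ n) {g : κ → N}
    (h : charDim k n g + 1 ≤ p) : (r : ℕ∞) < codim k n g := by
  rw [codim]
  split_ifs with h0
  · exact ENat.natCast_lt_top r
  · generalize charDim k n g = d at h h0
    lift d to ℕ∞ using h0
    have h' : d + 1 ≤ (p : ℕ∞) := by exact_mod_cast h
    have hd : d ≠ ⊤ := by
      rintro rfl
      simp at h'
    lift d to ℕ using hd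
    have h2 : d + 1 ≤ p := by exact_mod_cast h'
    have h3 : r < n - d := by omega
    show (r : ℕ∞) < (n : ℕ∞) - (d : ℕ∞)
    exact_mod_cast h3

/-- With `n = p + r`, codimension above `r` means dimension below `p`, and dimension `p` occurs
exactly when no nonzero operator of the subring kills `z`. -/
theorem mem_tSub_iff {r : ℕ} (hp : p + r = n) (hy : SolvedFrom k n p y)
    (hspan : Submodule.span (Op k n) (Set.range y) = ⊤) {z : N} :
    z ∈ tSub k n N r ↔ ∃ f ∈ SubOp k n p, f ≠ 0 ∧ f • z = 0 := by
  have hpn : p ≤ n := by omega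
  show (r : ℕ∞) < codim k n (fun _ : Unit => z) ↔ _
  constructor
  · intro h
    by_contra hcon
    rw [codim_eq hpn hy hspan (by simpa using hcon)] at h
    have : r < n - p := by exact_mod_cast h
    omega
  · rintro ⟨f, hfp, hf0, hf⟩
    exact lt_codim_of_charDim_succ_le hp.le (charDim_succ_le hpn hy hspan ⟨f, hfp, hf0, fun _ => hf⟩)

theorem tSub_eq_top {r s : ℕ} (hp : p + r = n) (hs : s < r) (hy : SolvedFrom k n p y)
    (hspan : Submodule.span (Op k n) (Set.range y) = ⊤) : tSub k n N s = ⊤ := by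
  refine eq_top_iff.mpr fun z _ => ?_
  -- The characteristic variety has dimension at most `p`, which is less than `p + 1 ≤ n - s`.
  refine lt_codim_of_charDim_succ_le (p := p + 1) (by omega) ?_
  push_cast
  exact add_le_add_left (charDim_le (by omega) hy hspan _) 1

theorem isPure_iff {r : ℕ} (hp : p + r = n) (hy : SolvedFrom k n p y)
    (hspan : Submodule.span (Op k n) (Set.range y) = ⊤) :
    IsPure k n N r ↔ tSub k n N r = ⊥ :=
  and_iff_left fun _ hs => tSub_eq_top hp (by omega) hy hspan

end Codimension

/-! ### Leading coefficients of combinations of first order operators -/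

section LeadingCoefficients

variable {k : Type*} [Field k]

theorem coeff_eq_zero_of_mem_supported {σ : Type*} {s : Set σ} {f : MvPolynomial σ k}
    (hf : f ∈ supported k s) {i : σ} (hi : i ∉ s) {μ : σ →₀ ℕ} (hμ : μ i ≠ 0) :
    coeff μ f = 0 := by
  classical
  by_contra h
  rw [mem_supported] at hf
  exact hi (hf ((mem_vars_iff_mem_support i).mpr
    ⟨μ, mem_support_iff.mpr h, Finsupp.mem_support_iff.mpr hμ⟩))

theorem eq_zero_of_X_mul_mem_supported {σ : Type*} {s : Set σ} {f : MvPolynomial σ k} {i : σ}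
    (hf : X i * f ∈ supported k s) (hi : i ∉ s) : f = 0 := by
  ext d
  rw [← coeff_X_mul d i f, coeff_zero]
  exact coeff_eq_zero_of_mem_supported hf hi (by simp)

theorem eq_single_of_degree_le_one {σ : Type*} {d : σ →₀ ℕ} (hd : d.degree ≤ 1) {i : σ}
    (hi : d i ≠ 0) : d = Finsupp.single i 1 := by
  have hle : Finsupp.single i 1 ≤ d := by
    rw [Finsupp.single_le_iff]
    exact Nat.one_le_iff_ne_zero.mpr hi
  obtain ⟨e, rfl⟩ := exists_add_of_le hle
  rw [map_add, Finsupp.degree_single] at hd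
  rw [(Finsupp.degree_eq_zero_iff e).mp (by omega), add_zero]

theorem degree_le_totalDegree {σ : Type*} {f : MvPolynomial σ k} {d : σ →₀ ℕ}
    (hd : coeff d f ≠ 0) : d.degree ≤ f.totalDegree :=
  le_totalDegree (mem_support_iff.mpr hd)

/-- The exponent of `i` in a monomial of `f` is at most `μ i`, so the second factor must supply a
variable `i`; having degree at most one, it supplies nothing else. -/
theorem coeff_add_single_mul {σ : Type*} {f g : MvPolynomial σ k} {i : σ} {μ : σ →₀ ℕ}
    (hf : ∀ d, coeff d f ≠ 0 → d i ≤ μ i) (hg : g.totalDegree ≤ 1) :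
    coeff (μ + Finsupp.single i 1) (f * g) = coeff μ f * coeff (Finsupp.single i 1) g := by
  classical
  rw [coeff_mul]
  refine Finset.sum_eq_single (μ, Finsupp.single i 1) (fun x hx hne => ?_) (fun hx => ?_)
  · by_contra hcon
    obtain ⟨h1, h2⟩ := mul_ne_zero_iff.mp hcon
    have hsum := Finset.HasAntidiagonal.mem_antidiagonal.mp hx
    have hi := DFunLike.congr_fun hsum i
    simp only [Finsupp.add_apply, Finsupp.single_eq_same] at hi
    have := hf _ h1
    have hx2 := eq_single_of_degree_le_one ((degree_le_totalDegree h2).trans hg) (i := i) (by omega)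
    rw [hx2] at hsum
    exact hne (Prod.ext (add_right_cancel hsum) hx2)
  · rw [Finset.HasAntidiagonal.mem_antidiagonal] at hx
    exact absurd rfl hx

theorem mem_subOp_of_coeff_eq_zero {n : ℕ} {i : Fin n} {f : Op k n}
    (hf : f ∈ SubOp k n (i + 1)) (hf1 : f.totalDegree ≤ 1)
    (h : coeff (Finsupp.single i 1) f = 0) : f ∈ SubOp k n i := by
  classical
  rw [mem_supported] at hf ⊢
  intro j hj
  have hj' : (j : ℕ) < i + 1 := hf hj
  rw [Finset.mem_coe, mem_vars_iff_mem_support] at hj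
  obtain ⟨d, hd, hjd⟩ := hj
  rw [mem_support_iff] at hd
  have hds := eq_single_of_degree_le_one ((degree_le_totalDegree hd).trans hf1)
    (Finsupp.mem_support_iff.mp hjd)
  have : j ≠ i := by
    rintro rfl
    exact hd (hds ▸ h)
  have h2 : (j : ℕ) ≠ i := fun h => this (Fin.ext h)
  show (j : ℕ) < i
  omega

variable (k) in
/-- The coefficients at a monomial of the components of a row vector of operators. -/
def coeffVec {n : ℕ} (m : ℕ) (μ : Fin n →₀ ℕ) : (Fin m → Op k n) →ₗ[k] (Fin m → k) :=
  LinearMap.compLeft (lcoeff k μ) (Fin m)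

variable {n m : ℕ}

@[simp]
theorem coeffVec_apply (μ : Fin n →₀ ℕ) (v : Fin m → Op k n) (a : Fin m) :
    coeffVec k m μ v a = coeff μ (v a) := rfl

/-- A nonzero combination of first order operators whose leading coefficients with respect to
`d_{i+1}` are independent has a leading coefficient in the span of those. -/
theorem exists_coeffVec_mem_map {i : Fin n} {G : Submodule k (Fin m → Op k n)}
    (hG1 : ∀ g ∈ G, ∀ a, (g a).totalDegree ≤ 1)
    (hG : ∀ g ∈ G, coeffVec k m (Finsupp.single i 1) g = 0 → g = 0)
    {h : Fin m → Op k n} (hh : h ∈ Submodule.span (Op k n) (G : Set (Fin m → Op k n)))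
    (h0 : h ≠ 0) :
    ∃ μ : Fin n →₀ ℕ, μ i ≠ 0 ∧ coeffVec k m μ h ≠ 0 ∧
      coeffVec k m μ h ∈ G.map (coeffVec k m (Finsupp.single i 1)) := by
  classical
  have hinj : Function.Injective ((coeffVec k m (Finsupp.single i 1)).domRestrict G) := by
    rw [injective_iff_map_eq_zero]
    exact fun g hg => Subtype.ext (hG g g.2 hg)
  have : Module.Finite k G := Module.Finite.of_injective _ hinj
  let b := Module.finBasis k G
  have hspan : Submodule.span (Op k n) (G : Set (Fin m → Op k n)) ≤
      Submodule.span (Op k n) (Set.range fun j => (b j : Fin m → Op k n)) := by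
    refine Submodule.span_le.mpr fun g hg => ?_
    have : g = ∑ j, (C (b.repr ⟨g, hg⟩ j) : Op k n) • (b j : Fin m → Op k n) := by
      conv_lhs => rw [show g = ((⟨g, hg⟩ : G) : Fin m → Op k n) from rfl, ← b.sum_repr ⟨g, hg⟩]
      rw [Submodule.coe_sum]
      refine Finset.sum_congr rfl fun j _ => ?_
      rw [Submodule.coe_smul]
      exact (algebraMap_smul (Op k n) (b.repr ⟨g, hg⟩ j) (b j : Fin m → Op k n)).symm
    rw [SetLike.mem_coe, this]
    exact sum_mem fun j _ => Submodule.smul_mem _ _ (Submodule.subset_span ⟨j, rfl⟩)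
  obtain ⟨f, rfl⟩ := (Submodule.mem_span_range_iff_exists_fun _).mp (hspan hh)
  have hne : (Finset.univ.biUnion fun j => (f j).support).Nonempty := by
    by_contra hemp
    refine h0 (Finset.sum_eq_zero fun j _ => ?_)
    have : (f j).support = ∅ := by
      refine Finset.subset_empty.mp ((Finset.subset_biUnion_of_mem (fun j => (f j).support)
        (Finset.mem_univ j)).trans ?_)
      rw [Finset.not_nonempty_iff_eq_empty.mp hemp]
    rw [support_eq_empty.mp this, zero_smul]
  -- Only the exponent of `d_{i+1}` is maximized, over all coefficients at once. The coefficient of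
  -- the combination at `μ` times `d_{i+1}` is then a combination of leading coefficients of the
  -- basis, nontrivial by the choice of `μ`, hence nonzero by independence.
  obtain ⟨μ, hμ, hmax⟩ := Finset.exists_max_image _ (fun d : Fin n →₀ ℕ => d i) hne
  obtain ⟨j₀, -, hj₀⟩ := Finset.mem_biUnion.mp hμ
  have hle : ∀ j d, coeff d (f j) ≠ 0 → d i ≤ μ i := fun j d hd =>
    hmax d (Finset.mem_biUnion.mpr ⟨j, Finset.mem_univ j, mem_support_iff.mpr hd⟩)
  have hmul : ∀ j a, coeff (μ + Finsupp.single i 1) (f j * (b j : Fin m → Op k n) a) =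
      coeff μ (f j) * coeff (Finsupp.single i 1) ((b j : Fin m → Op k n) a) :=
    fun j a => coeff_add_single_mul (hle j) (hG1 _ (b j).2 a)
  let g : G := ∑ j, coeff μ (f j) • b j
  have hcoeff : coeffVec k m (μ + Finsupp.single i 1) (∑ j, f j • (b j : Fin m → Op k n)) =
      coeffVec k m (Finsupp.single i 1) g := by
    funext a
    simp only [g, Submodule.coe_sum, Submodule.coe_smul, coeffVec_apply, Finset.sum_apply,
      Pi.smul_apply, smul_eq_mul, coeff_sum, hmul, coeff_smul]
  refine ⟨μ + Finsupp.single i 1, by simp, ?_, ?_⟩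
  · rw [hcoeff]
    intro hz
    have hg : g = 0 := Subtype.ext (hG g g.2 hz)
    exact mem_support_iff.mp hj₀
      (Fintype.linearIndependent_iff.mp b.linearIndependent _ hg j₀)
  · rw [hcoeff]
    exact Submodule.mem_map_of_mem g.2

variable (k n m) in
/-- The row vectors of operators in the first `p` derivations. -/
def subOpVec (p : ℕ) : Submodule k (Fin m → Op k n) where
  carrier := {v | ∀ a, v a ∈ SubOp k n p}
  zero_mem' := fun _ => zero_mem _
  add_mem' := fun hv hw a => add_mem (hv a) (hw a)
  smul_mem' := fun c _ hv a => Subalgebra.smul_mem _ (hv a) c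

variable (k n) in
theorem subOp_self : SubOp k n n = ⊤ := by
  have : {j : Fin n | (j : ℕ) < n} = Set.univ := Set.eq_univ_of_forall fun j => j.2
  unfold SubOp
  rw [this, supported_univ]

variable (k n) in
theorem subOp_zero : SubOp k n 0 = ⊥ := by
  have : {j : Fin n | (j : ℕ) < 0} = ∅ := Set.eq_empty_of_forall_notMem fun j => Nat.not_lt_zero _
  unfold SubOp
  rw [this, supported_empty]

theorem subOp_mono {p q : ℕ} (h : p ≤ q) : SubOp k n p ≤ SubOp k n q :=
  supported_mono fun _ hj => lt_of_lt_of_le hj h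

theorem coeffVec_eq_zero_of_mem_subOpVec {p : ℕ} {v : Fin m → Op k n}
    (hv : v ∈ subOpVec k n m p) {i : Fin n} (hi : p ≤ i) {μ : Fin n →₀ ℕ} (hμ : μ i ≠ 0) :
    coeffVec k m μ v = 0 :=
  funext fun a => coeff_eq_zero_of_mem_supported (hv a) (not_lt.mpr hi) hμ

/-- A `k`-space of row vectors stable under the first `p` derivations is stable under the operators
in these derivations. -/
theorem smul_mem_of_X_smul_mem {p : ℕ} {P : Submodule k (Fin m → Op k n)}
    (hP : ∀ j : Fin n, (j : ℕ) < p → ∀ v ∈ P, (X j : Op k n) • v ∈ P) {f : Op k n}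
    (hf : f ∈ SubOp k n p) {v : Fin m → Op k n} (hv : v ∈ P) : f • v ∈ P := by
  rw [SubOp, supported_eq_adjoin_X] at hf
  induction hf using Algebra.adjoin_induction generalizing v with
  | mem x hx =>
    obtain ⟨j, hj, rfl⟩ := hx
    exact hP j hj v hv
  | algebraMap c =>
    rw [algebraMap_smul]
    exact P.smul_mem c hv
  | add x y _ _ hx hy => rw [add_smul]; exact add_mem (hx hv) (hy hv)
  | mul x y _ _ hx hy => rw [mul_smul]; exact hx (hy hv)

end LeadingCoefficients

/-! ### Involutive systems: normal form, injectivity and solved derivatives -/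

namespace FirstOrderSystem

variable {k : Type*} [Field k] {n m : ℕ} (S : FirstOrderSystem k n m)

theorem eqnsUpTo_mono {p q : ℕ} (h : p ≤ q) : S.eqnsUpTo p ≤ S.eqnsUpTo q :=
  fun _ hv => ⟨hv.1, fun a => subOp_mono h (hv.2 a)⟩

theorem eqnsUpTo_zero : S.eqnsUpTo 0 = ⊥ := by
  refine (Submodule.eq_bot_iff _).mpr fun v hv => S.no_zero_order v hv.1 fun a => ?_
  have := hv.2 a
  rw [subOp_zero] at this
  obtain ⟨c, hc⟩ := Algebra.mem_bot.mp this
  rw [← hc]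
  exact totalDegree_C c

theorem eqnsUpTo_top : S.eqnsUpTo n = S.eqns := by
  refine le_antisymm (fun v hv => hv.1) fun v hv => ⟨hv, fun a => ?_⟩
  rw [subOp_self]
  exact Algebra.mem_top

/-- The leading coefficients with respect to `d_{i+1}` of the equations of class `≤ i + 1`. -/
def leadingCoeffs (i : Fin n) : Submodule k (Fin m → k) :=
  (S.eqnsUpTo (i + 1)).map (coeffVec k m (Finsupp.single i 1))

variable (G : Fin n → Submodule k (Fin m → Op k n))

/-- The span of the multiplicative prolongations of the equations of class `≤ p`. -/
def multProlong (p : ℕ) : Submodule k (Fin m → Op k n) :=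
  ⨆ i : Fin n, ⨆ _ : (i : ℕ) < p,
    (Submodule.span (SubOp k n (i + 1)) (G i : Set (Fin m → Op k n))).restrictScalars k

variable {G}

theorem le_multProlong {i : Fin n} {p : ℕ} (h : (i : ℕ) < p) :
    (Submodule.span (SubOp k n (i + 1)) (G i : Set (Fin m → Op k n))).restrictScalars k ≤
      multProlong G p :=
  le_iSup₂_of_le i h le_rfl

theorem multProlong_zero : multProlong G 0 = ⊥ := by
  simp [multProlong]

theorem exists_add_of_mem_multProlong_succ {i : Fin n} {v : Fin m → Op k n}
    (hv : v ∈ multProlong G (i + 1)) :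
    ∃ u ∈ multProlong G i, ∃ h ∈ Submodule.span (SubOp k n (i + 1)) (G i : Set (Fin m → Op k n)),
      u + h = v := by
  have hle : multProlong G (i + 1) ≤ multProlong G i ⊔
      (Submodule.span (SubOp k n (i + 1)) (G i : Set (Fin m → Op k n))).restrictScalars k := by
    refine iSup₂_le fun j hj => ?_
    rcases Nat.lt_succ_iff_lt_or_eq.mp hj with h | h
    · exact (le_multProlong h).trans le_sup_left
    · obtain rfl : j = i := Fin.ext h
      exact le_sup_right
  obtain ⟨u, hu, h, hh, rfl⟩ := Submodule.mem_sup.mp (hle hv)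
  exact ⟨u, hu, h, hh, rfl⟩

theorem span_subOp_le {p : ℕ} {T : Set (Fin m → Op k n)} {v : Fin m → Op k n}
    (hv : v ∈ Submodule.span (SubOp k n p) T) : v ∈ Submodule.span (Op k n) T :=
  Submodule.span_le_restrictScalars (SubOp k n p) (Op k n) T hv

variable {S}

theorem multProlong_le_subOpVec (hG : ∀ i : Fin n, G i ≤ S.eqnsUpTo (i + 1)) (p : ℕ) :
    multProlong G p ≤ subOpVec k n m p := by
  refine iSup₂_le fun i hi v hv => ?_
  induction hv using Submodule.span_induction with
  | mem x hx => exact fun a => subOp_mono hi ((hG i hx).2 a)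
  | zero => exact zero_mem _
  | add x y _ _ hx hy => exact add_mem hx hy
  | smul c x _ hx => exact fun a => mul_mem (subOp_mono hi c.2) (hx a)

theorem le_multProlong_of_le (hG : ∀ i : Fin n, S.eqnsUpTo i ⊔ G i = S.eqnsUpTo (i + 1))
    {p : ℕ} (hp : p ≤ n) : S.eqnsUpTo p ≤ multProlong G p := by
  induction p with
  | zero => rw [eqnsUpTo_zero]; exact bot_le
  | succ p ih =>
    rw [← hG ⟨p, hp⟩]
    refine sup_le ((ih (by omega)).trans ?_) ?_
    · exact iSup_mono fun i => iSup_mono' fun h => ⟨Nat.lt_succ_of_lt h, le_rfl⟩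
    · exact fun v hv => le_multProlong (i := ⟨p, hp⟩) (Nat.lt_succ_self p)
        (Submodule.subset_span hv)

/-- Involution controls only the first prolongation; this carries it to all orders. For a
nonmultiplicative `d_j` and a prolongation `c g`, the equation `d_j g` is already spanned by
multiplicative prolongations, and `c` involves only derivations of smaller index, under which the
span is stable by induction on `j`. -/
theorem X_smul_mem_multProlong
    (hG : ∀ i : Fin n, S.eqnsUpTo i ⊔ G i = S.eqnsUpTo (i + 1))
    (hprol : S.prolongation = S.eqns ⊔ ⨆ i : Fin n, ⨆ j : Fin n, ⨆ _ : j ≤ i,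
      (G i).map (formalDeriv k m j)) (j : Fin n) :
    ∀ v ∈ multProlong G n, (X j : Op k n) • v ∈ multProlong G n := by
  have hXsmul : ∀ (j : Fin n) (v : Fin m → Op k n), formalDeriv k m j v = (X j : Op k n) • v :=
    fun _ _ => rfl
  have hE : S.eqns ≤ multProlong G n := S.eqnsUpTo_top ▸ le_multProlong_of_le hG le_rfl
  have hpr : S.prolongation ≤ multProlong G n := by
    rw [hprol]
    refine sup_le hE (iSup_le fun i => iSup₂_le fun j hj => ?_)
    rintro _ ⟨g, hg, rfl⟩
    refine le_multProlong i.2 ?_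
    have hji : (j : ℕ) < i + 1 := Nat.lt_succ_of_le hj
    exact Submodule.smul_mem _ (⟨X j, X_mem_supported.mpr hji⟩ : SubOp k n (i + 1))
      (Submodule.subset_span hg)
  induction j using WellFoundedLT.induction with
  | ind j ih =>
    intro v hv
    suffices hle : multProlong G n ≤ (multProlong G n).comap (formalDeriv k m j) from hle hv
    refine iSup₂_le fun i hi v hv => ?_
    rw [Submodule.mem_comap, hXsmul]
    by_cases hji : (j : ℕ) < i + 1
    · exact le_multProlong hi
        (Submodule.smul_mem _ (⟨X j, X_mem_supported.mpr hji⟩ : SubOp k n (i + 1)) hv)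
    · induction hv using Submodule.span_induction with
      | mem g hg =>
        refine hpr (le_sup_right (a := S.eqns) (Submodule.mem_iSup_of_mem j ⟨g, ?_, rfl⟩))
        exact ((le_sup_right.trans_eq (hG i)) hg).1
      | zero => rw [smul_zero]; exact zero_mem _
      | add x y _ _ hx hy => rw [smul_add]; exact add_mem hx hy
      | smul c x _ hx =>
        have hc : (c : Op k n) ∈ SubOp k n j := subOp_mono (not_lt.mp hji) c.2
        rw [show c • x = (c : Op k n) • x from rfl, smul_comm]
        exact smul_mem_of_X_smul_mem (fun l hl => ih l hl) hc hx

/-- The equations of an involutive system and all their derivatives are spanned by the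
multiplicative prolongations. -/
theorem mem_multProlong_of_mem_span
    (hG : ∀ i : Fin n, S.eqnsUpTo i ⊔ G i = S.eqnsUpTo (i + 1))
    (hprol : S.prolongation = S.eqns ⊔ ⨆ i : Fin n, ⨆ j : Fin n, ⨆ _ : j ≤ i,
      (G i).map (formalDeriv k m j)) {v : Fin m → Op k n}
    (hv : v ∈ Submodule.span (Op k n) (S.eqns : Set (Fin m → Op k n))) :
    v ∈ multProlong G n := by
  induction hv using Submodule.span_induction with
  | mem g hg => exact le_multProlong_of_le hG le_rfl (S.eqnsUpTo_top.symm ▸ hg)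
  | zero => exact zero_mem _
  | add x y _ _ hx hy => exact add_mem hx hy
  | smul c x _ hx =>
    refine smul_mem_of_X_smul_mem (p := n)
      (fun j _ => X_smul_mem_multProlong hG hprol j) ?_ hx
    rw [subOp_self]
    exact Algebra.mem_top

/-- An equation in `G i` without `d_{i+1}` has lower class, hence lies in the space to which `G i`
is complementary. -/
theorem eq_zero_of_coeffVec_eq_zero
    (hG : ∀ i : Fin n, S.eqnsUpTo i ⊔ G i = S.eqnsUpTo (i + 1))
    (hdisj : ∀ i : Fin n, Disjoint (S.eqnsUpTo i) (G i)) (i : Fin n) :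
    ∀ g ∈ G i, coeffVec k m (Finsupp.single i 1) g = 0 → g = 0 := by
  intro g hg h0
  have hgE := (le_sup_right.trans_eq (hG i)) hg
  refine Submodule.disjoint_def.mp (hdisj i) g ⟨hgE.1, fun a => ?_⟩ hg
  exact mem_subOp_of_coeff_eq_zero (hgE.2 a) (S.order_le_one g hgE.1 a) (congrFun h0 a)

/-- The leading coefficient of a multiplicative prolongation that involves `d_{i+1}`. -/
theorem exists_leadingCoeff
    (hG : ∀ i : Fin n, S.eqnsUpTo i ⊔ G i = S.eqnsUpTo (i + 1))
    (hdisj : ∀ i : Fin n, Disjoint (S.eqnsUpTo i) (G i)) {i : Fin n} {v : Fin m → Op k n}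
    (hv : v ∈ multProlong G (i + 1)) (hvi : v ∉ multProlong G i) :
    ∃ μ : Fin n →₀ ℕ, μ i ≠ 0 ∧ coeffVec k m μ v ≠ 0 ∧ coeffVec k m μ v ∈ S.leadingCoeffs i := by
  have hGE : ∀ i : Fin n, G i ≤ S.eqnsUpTo (i + 1) := fun i => le_sup_right.trans_eq (hG i)
  obtain ⟨u, hu, h, hh, rfl⟩ := exists_add_of_mem_multProlong_succ hv
  have h0 : h ≠ 0 := by
    rintro rfl
    exact hvi (by rwa [add_zero])
  obtain ⟨μ, hμ, hne, hmem⟩ := exists_coeffVec_mem_map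
    (fun g hg => S.order_le_one g (hGE i hg).1) (eq_zero_of_coeffVec_eq_zero hG hdisj i)
    (span_subOp_le hh) h0
  have hadd : coeffVec k m μ (u + h) = coeffVec k m μ h := by
    rw [map_add, coeffVec_eq_zero_of_mem_subOpVec (multProlong_le_subOpVec hGE i hu) le_rfl hμ,
      zero_add]
  exact ⟨μ, hμ, hadd ▸ hne, hadd ▸ Submodule.map_mono (hGE i) hmem⟩

/-- Descend through the classes: a part of class `q + 1` that could not be dropped would leave a
nonzero coefficient at a monomial containing `d_{q+1}`. -/
theorem mem_multProlong_of_mem_subOpVec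
    (hG : ∀ i : Fin n, S.eqnsUpTo i ⊔ G i = S.eqnsUpTo (i + 1))
    (hdisj : ∀ i : Fin n, Disjoint (S.eqnsUpTo i) (G i)) {p q : ℕ} (hpq : p ≤ q) (hq : q ≤ n)
    {v : Fin m → Op k n} (hv : v ∈ multProlong G q) (hvp : v ∈ subOpVec k n m p) :
    v ∈ multProlong G p := by
  induction q, hpq using Nat.le_induction with
  | base => exact hv
  | succ q hpq ih =>
    refine ih (by omega) ?_
    by_contra hcon
    obtain ⟨μ, hμ, hne, -⟩ := exists_leadingCoeff hG hdisj (i := ⟨q, hq⟩) hv hcon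
    exact hne (coeffVec_eq_zero_of_mem_subOpVec hvp hpq hμ)

theorem exists_mem_span_of_mem_multProlong (hG : ∀ i : Fin n, G i ≤ S.eqnsUpTo (i + 1)) {p : ℕ}
    {v : Fin m → Op k n} (hv : v ∈ multProlong G p) :
    ∃ w ∈ Submodule.span (SubOp k n p)
      {w : Fin m → SubOp k n p | (fun a => (w a : Op k n)) ∈ S.eqnsUpTo p},
      (fun a => (w a : Op k n)) = v := by
  let φ := LinearMap.compLeft (Algebra.linearMap (SubOp k n p) (Op k n)) (Fin m)
  let Q := (Submodule.span (SubOp k n p)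
      {w : Fin m → SubOp k n p | (fun a => (w a : Op k n)) ∈ S.eqnsUpTo p}).map φ
  suffices hle : multProlong G p ≤ Q.restrictScalars k from hle hv
  refine iSup₂_le fun i hi v hv => ?_
  induction hv using Submodule.span_induction with
  | mem g hg =>
    have hgp := S.eqnsUpTo_mono hi (hG i hg)
    exact ⟨fun a => ⟨g a, hgp.2 a⟩, Submodule.subset_span hgp, rfl⟩
  | zero => exact zero_mem _
  | add x y _ _ hx hy => exact add_mem hx hy
  | smul c x _ hx =>
    exact Q.smul_mem (⟨c, subOp_mono hi c.2⟩ : SubOp k n p) hx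

/-- The module of the equations of class `≤ p` embeds in the module of the system. -/
theorem specialize_injective (hS : S.IsInvolutive) {p : ℕ} (hp : p ≤ n) :
    Function.Injective (S.specialize p) := by
  obtain ⟨G, hG, hprol⟩ := hS
  have hsup := fun i => (hG i).2
  have hdisj := fun i => (hG i).1
  rw [injective_iff_map_eq_zero]
  intro x hx
  obtain ⟨v, rfl⟩ := Submodule.Quotient.mk_surjective _ x
  have hv : (fun a => (v a : Op k n)) ∈
      Submodule.span (Op k n) (S.eqns : Set (Fin m → Op k n)) :=
    (Submodule.Quotient.mk_eq_zero _).mp hx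
  have h1 := mem_multProlong_of_mem_subOpVec hsup hdisj hp le_rfl
    (mem_multProlong_of_mem_span hsup hprol hv) fun a => (v a).2
  obtain ⟨w, hw, hwv⟩ := exists_mem_span_of_mem_multProlong
    (fun i => le_sup_right.trans_eq (hsup i)) h1
  obtain rfl : w = v := funext fun a => Subtype.ext (congrFun hwv a)
  exact (Submodule.Quotient.mk_eq_zero _).mpr hw

variable (S) in
theorem mk_eq_sum_gen (v : Fin m → Op k n) :
    (Submodule.Quotient.mk v : S.Mod) = ∑ a, v a • S.gen a := by
  have : v = ∑ a, v a • (Pi.single a 1 : Fin m → Op k n) := by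
    funext b
    simp [Finset.sum_apply, Pi.single_apply]
  conv_lhs => rw [this]
  exact map_sum (Submodule.mkQ _) _ _

variable (S) in
theorem span_gen : Submodule.span (Op k n) (Set.range S.gen) = ⊤ := by
  refine eq_top_iff.mpr fun x _ => ?_
  obtain ⟨v, rfl⟩ := Submodule.Quotient.mk_surjective _ x
  rw [mk_eq_sum_gen]
  exact sum_mem fun a _ => Submodule.smul_mem _ _ (Submodule.subset_span ⟨a, rfl⟩)

theorem gen_mem_combosLE {ι : Type*} [Fintype ι] {N : Type*} [AddCommGroup N] [Module (Op k n) N]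
    (p : ℕ) (y : ι → N) (a : ι) : y a ∈ combosLE k n p y 0 := by
  classical
  refine ⟨Pi.single a 1, fun b => ?_, fun b => ?_, by simp [Pi.single_apply, ite_smul]⟩
  · rw [Pi.single_apply]
    split_ifs
    exacts [one_mem _, zero_mem _]
  · rw [Pi.single_apply]
    split_ifs <;> simp

/-- Some equation of class `j + 1` has `d_{j+1} y^a` as its leading part. What remains involves
derivatives of lower index, those beyond the first `p` being solved already by induction. -/
theorem solvedFrom_gen {p : ℕ} (hlead : ∀ i : Fin n, p ≤ i → S.leadingCoeffs i = ⊤) :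
    SolvedFrom k n p S.gen := by
  intro j hj
  induction j using WellFoundedLT.induction with
  | ind j ih =>
    intro a
    have hlow : ∀ f ∈ SubOp k n j, f.totalDegree ≤ 1 → ∀ b, f • S.gen b ∈ combosLE k n p S.gen 1 := by
      intro f hf hf1 b
      rw [← support_sum_monomial_coeff f, Finset.sum_smul]
      refine sum_mem fun d hd => ?_
      have hd1 : d.degree ≤ 1 := (le_totalDegree hd).trans hf1
      have hC : ∀ c : k, (C c : Op k n) ∈ SubOp k n p := fun c => Subalgebra.algebraMap_mem _ c
      by_cases hd0 : d = 0
      · rw [hd0, monomial_zero']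
        exact combosLE_mono (Nat.zero_le 1)
          (smul_mem_combosLE (hC _) (totalDegree_C _).le (gen_mem_combosLE p _ b))
      · obtain ⟨l, hl⟩ := Finsupp.ne_iff.mp hd0
        rw [Finsupp.zero_apply] at hl
        have hlj : l < j := by
          by_contra hlj
          exact mem_support_iff.mp hd (coeff_eq_zero_of_mem_supported hf (i := l)
            (fun h => hlj h) hl)
        have hds := eq_single_of_degree_le_one hd1 hl
        have hmon : (monomial d (coeff d f) : Op k n) = C (coeff d f) * X l := by
          rw [hds, C_mul_X_eq_monomial]
        rw [hmon, mul_smul, ← zero_add 1]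
        refine smul_mem_combosLE (hC _) (totalDegree_C _).le ?_
        by_cases hlp : (l : ℕ) < p
        · exact smul_mem_combosLE (d := 1) (X_mem_supported.mpr hlp) (totalDegree_X _).le
            (gen_mem_combosLE p _ b)
        · exact ih l hlj (not_lt.mp hlp) b
    have hA : (Pi.single a 1 : Fin m → k) ∈ S.leadingCoeffs j := hlead j hj ▸ Submodule.mem_top
    obtain ⟨g, hg, hga⟩ := hA
    let w : Fin m → Op k n := Pi.single a (X j) - g
    have hw1 : ∀ b, (w b).totalDegree ≤ 1 := by
      intro b
      refine (totalDegree_sub _ _).trans (max_le ?_ (S.order_le_one g hg.1 b))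
      rw [Pi.single_apply]
      split_ifs
      · exact (totalDegree_X j).le
      · simp
    have hw : ∀ b, w b ∈ SubOp k n j := by
      intro b
      refine mem_subOp_of_coeff_eq_zero (sub_mem ?_ (hg.2 b)) (hw1 b) ?_
      · rw [Pi.single_apply]
        split_ifs
        · exact X_mem_supported.mpr (Nat.lt_succ_self (j : ℕ))
        · exact zero_mem _
      · have hgb : coeff (Finsupp.single j 1) (g b) = (Pi.single a 1 : Fin m → k) b :=
          congrFun hga b
        rw [show w b = (Pi.single a (X j) : Fin m → Op k n) b - g b from rfl, coeff_sub, hgb, Pi.single_apply, Pi.single_apply]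
        split_ifs
        · rw [coeff_X, if_pos rfl, sub_self]
        · simp
    have hXa : (X j : Op k n) • S.gen a = Submodule.Quotient.mk w := by
      have : (X j : Op k n) • S.gen a = Submodule.Quotient.mk (Pi.single a (X j)) := by
        rw [mk_eq_sum_gen]
        simp [Pi.single_apply, ite_smul]
      rw [this, eq_comm, ← sub_eq_zero, ← Submodule.Quotient.mk_sub,
        Submodule.Quotient.mk_eq_zero]
      simpa [w] using Submodule.subset_span (R := Op k n) hg.1
    have hmem : (X j : Op k n) • S.gen a ∈ combosLE k n p S.gen 1 := by
      rw [hXa, mk_eq_sum_gen]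
      exact sum_mem fun b _ => hlow _ (hw b) (hw1 b) b
    exact hmem

/-- If `f` killed all the generators, every vector `c f A` with `A` in k^m would be a consequence of
the system. In the last class `p` whose leading coefficients do not fill k^m, choose `A` outside
them: the leading coefficient of such a consequence is a nonzero multiple of `A`, a contradiction.
-/
theorem not_exists_smul_gen_eq_zero (hS : S.IsInvolutive) (hm : 0 < m) {p : ℕ}
    (hp : p = 0 ∨ ∃ i : Fin n, (i : ℕ) + 1 = p ∧ S.leadingCoeffs i ≠ ⊤) :
    ¬ ∃ f ∈ SubOp k n p, f ≠ 0 ∧ ∀ a, f • S.gen a = 0 := by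
  rintro ⟨f, hfp, hf0, hf⟩
  obtain ⟨G, hG, hprol⟩ := hS
  have hsup := fun i => (hG i).2
  have hdisj := fun i => (hG i).1
  have hmem : ∀ (c : Op k n) (A : Fin m → k), (fun a => c * f * C (A a)) ∈ multProlong G n := by
    intro c A
    refine mem_multProlong_of_mem_span hsup hprol ((Submodule.Quotient.mk_eq_zero _).mp ?_)
    rw [mk_eq_sum_gen]
    refine Finset.sum_eq_zero fun a _ => ?_
    rw [mul_right_comm, mul_smul, hf, smul_zero]
  rcases hp with rfl | ⟨i, rfl, hi⟩
  · have h1 := mem_multProlong_of_mem_subOpVec hsup hdisj (Nat.zero_le n) le_rfl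
      (hmem 1 fun _ => 1) fun a => by simpa using hfp
    rw [multProlong_zero, Submodule.mem_bot] at h1
    have := congrFun h1 ⟨0, hm⟩
    simp at this
    exact hf0 this
  · obtain ⟨A, -, hA⟩ := SetLike.exists_of_lt (lt_top_iff_ne_top.mpr hi)
    -- The extra factor `d_{i+1}` forces the class to be exactly `i + 1`, even when `f` does not
    -- involve this derivation.
    have hX : X i * f ∈ SubOp k n (i + 1) :=
      mul_mem (X_mem_supported.mpr (Nat.lt_succ_self (i : ℕ))) hfp
    have h1 := mem_multProlong_of_mem_subOpVec hsup hdisj (p := i + 1) i.2 le_rfl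
      (hmem (X i) A) fun a => mul_mem hX (Subalgebra.algebraMap_mem _ (A a))
    obtain ⟨a, ha⟩ : ∃ a, A a ≠ 0 := by
      by_contra! h
      exact hA (by rw [show A = 0 from funext h]; exact zero_mem _)
    have h2 : (fun a => X i * f * C (A a)) ∉ multProlong G i := by
      intro hcon
      have := multProlong_le_subOpVec (fun i => le_sup_right.trans_eq (hsup i)) i hcon a
      simp only [mul_assoc] at this
      have h0 := eq_zero_of_X_mul_mem_supported this (by simp)
      rcases mul_eq_zero.mp h0 with h | h
      · exact hf0 h
      · exact ha (C_eq_zero.mp h)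
    obtain ⟨μ, -, hne, hlead⟩ := exists_leadingCoeff hsup hdisj h1 h2
    have hsm : coeffVec k m μ (fun a => X i * f * C (A a)) = coeff μ (X i * f) • A := by
      funext b
      rw [coeffVec_apply, mul_comm, coeff_C_mul, mul_comm]
      rfl
    rw [hsm] at hne hlead
    exact hA ((Submodule.smul_mem_iff _ (fun h => hne (by rw [h, zero_smul]))).mp hlead)

variable (S) in
theorem exists_leadingCoeffs_eq_top :
    ∃ p ≤ n, (∀ i : Fin n, p ≤ (i : ℕ) → S.leadingCoeffs i = ⊤) ∧
      (p = 0 ∨ ∃ i : Fin n, (i : ℕ) + 1 = p ∧ S.leadingCoeffs i ≠ ⊤) := by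
  classical
  have hex : ∃ p, ∀ i : Fin n, p ≤ (i : ℕ) → S.leadingCoeffs i = ⊤ :=
    ⟨n, fun i hi => absurd i.2 (not_lt.mpr hi)⟩
  refine ⟨Nat.find hex, Nat.find_min' hex fun i hi => absurd i.2 (not_lt.mpr hi),
    Nat.find_spec hex, ?_⟩
  rcases Nat.eq_zero_or_pos (Nat.find hex) with h | h
  · exact Or.inl h
  · right
    have hmin := Nat.find_min hex (m := Nat.find hex - 1) (by omega)
    push Not at hmin
    obtain ⟨i, hi, hne⟩ := hmin
    refine ⟨i, ?_, hne⟩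
    by_contra hcon
    exact hne (Nat.find_spec hex i (by omega))

theorem cd_eq_top_of_isEmpty (hm : m = 0) : S.cd = ⊤ := by
  subst hm
  have h : charIdeal k n S.gen = ⊤ := by
    rw [charIdeal, Ideal.radical_eq_top]
    exact Module.annihilator_eq_top_iff.mpr inferInstance
  have : charDim k n S.gen = ⊥ := by
    rw [charDim, h]
    exact ringKrullDim_eq_bot_of_subsingleton
  simp [cd, codim, this]

/-- An involutive system of codimension `r` is solved with respect to the derivatives of class
`> n - r`. -/
theorem solvedFrom_of_cd_eq (hS : S.IsInvolutive) {r : ℕ} (hr : S.cd = r) :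
    n - r + r = n ∧ SolvedFrom k n (n - r) S.gen := by
  -- Without unknowns the module is zero, of codimension `∞`.
  have hm : 0 < m := by
    by_contra! h
    rw [cd_eq_top_of_isEmpty (Nat.le_zero.mp h)] at hr
    exact ENat.top_ne_natCast r hr
  obtain ⟨p, hpn, hlead, hp⟩ := S.exists_leadingCoeffs_eq_top
  have hsolved := solvedFrom_gen hlead
  have hcd := codim_eq hpn hsolved S.span_gen (not_exists_smul_gen_eq_zero hS hm hp)
  have hnr : n - p = r := by
    have : ((n - p : ℕ) : ℕ∞) = r := hcd.symm.trans hr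
    exact_mod_cast this
  have hpr : n - r = p := by omega
  rw [hpr]
  exact ⟨by omega, hsolved⟩

theorem specialize_surjective {p : ℕ} (h : SolvedFrom k n p S.gen) :
    Function.Surjective (S.specialize p) := by
  have hcomb : ∀ w : Fin m → Op k n, (∀ b, w b ∈ SubOp k n p) →
      ∑ b, w b • S.gen b ∈ LinearMap.range (S.specialize p) := fun w hw =>
    ⟨Submodule.Quotient.mk fun b => ⟨w b, hw b⟩, S.mk_eq_sum_gen w⟩
  intro x
  obtain ⟨v, rfl⟩ := Submodule.Quotient.mk_surjective _ x
  rw [mk_eq_sum_gen]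
  refine (sum_mem fun a _ => ?_ :
    ∑ a, v a • S.gen a ∈ LinearMap.range (S.specialize p))
  obtain ⟨w, hw, -, hwe⟩ := smul_mem_combosLE_of_solvedFrom h (le_refl (v a).totalDegree) a
  rw [hwe]
  exact hcomb w hw

end FirstOrderSystem

/-! ### Torsion under extension to a free algebra -/

section FreeExtension

variable {R A : Type*} [CommRing R] [CommRing A] [Algebra R A] {ι : Type*}

variable (A) in
/-- The rows of a family of vectors, with the coefficients extended to an algebra. -/
def extendSet (T : Set (ι → R)) : Set (ι → A) := (fun w a => algebraMap R A (w a)) '' T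

variable {κ : Type*} (b : Module.Basis κ R A)

theorem coord_mem_span {T : Set (ι → R)} {v : ι → A}
    (hv : v ∈ Submodule.span A (extendSet A T)) (β : κ) :
    (fun a => b.coord β (v a)) ∈ Submodule.span R T := by
  -- Coordinates are not `A`-linear; quantifying over all multiples `f` makes the condition stable
  -- under `A`.
  suffices h : Submodule.span A (extendSet A T) ≤
      ({ carrier := {v | ∀ f : A, (fun a => b.coord β (f * v a)) ∈ Submodule.span R T}
         zero_mem' := fun f => by
          simp only [Pi.zero_apply, mul_zero, map_zero]
          exact Submodule.zero_mem _
         add_mem' := fun {x y} hx hy f => by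
          simp only [Pi.add_apply, mul_add, map_add]
          exact add_mem (hx f) (hy f)
         smul_mem' := fun c x hx f => by
          simpa only [Pi.smul_apply, smul_eq_mul, mul_assoc] using hx (f * c) } :
        Submodule A (ι → A)) by
    simpa using h hv 1
  refine Submodule.span_le.mpr ?_
  rintro _ ⟨w, hw, rfl⟩ f
  have : (fun a => b.coord β (f * algebraMap R A (w a))) = b.coord β f • w := by
    funext a
    rw [mul_comm, ← Algebra.smul_def, map_smul, Pi.smul_apply, smul_eq_mul, smul_eq_mul, mul_comm]
  rw [this]
  exact Submodule.smul_mem _ _ (Submodule.subset_span hw)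

theorem extend_mem_span {T : Set (ι → R)} {w : ι → R} (hw : w ∈ Submodule.span R T) :
    (fun a => algebraMap R A (w a)) ∈ Submodule.span A (extendSet A T) := by
  suffices h : Submodule.span R T ≤ ((Submodule.span A (extendSet A T)).restrictScalars R).comap
      ((Algebra.linearMap R A).compLeft ι) from h hw
  exact Submodule.span_le.mpr fun w hw => Submodule.subset_span ⟨w, hw, rfl⟩

variable [Fintype ι]

theorem exists_finset_coord (v : ι → A) :
    ∃ B : Finset κ, (∀ β ∉ B, ∀ a, b.coord β (v a) = 0) ∧
      v = ∑ β ∈ B, b β • fun a => algebraMap R A (b.coord β (v a)) := by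
  classical
  have h0 : ∀ β ∉ Finset.univ.biUnion fun a => (b.repr (v a)).support,
      ∀ a, b.coord β (v a) = 0 := by
    intro β hβ a
    by_contra h
    exact hβ (Finset.mem_biUnion.mpr ⟨a, Finset.mem_univ a, Finsupp.mem_support_iff.mpr h⟩)
  refine ⟨_, h0, funext fun a => ?_⟩
  conv_lhs => rw [← b.linearCombination_repr (v a), Finsupp.linearCombination_apply]
  rw [Finsupp.sum_of_support_subset _ (Finset.subset_biUnion_of_mem
    (fun a => (b.repr (v a)).support) (Finset.mem_univ a)) _ (by simp), Finset.sum_apply]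
  refine Finset.sum_congr rfl fun β _ => ?_
  rw [Pi.smul_apply, smul_eq_mul, mul_comm, ← Algebra.smul_def]
  rfl

theorem mem_span_of_coord_mem {T : Set (ι → R)} {v : ι → A}
    (hv : ∀ β, (fun a => b.coord β (v a)) ∈ Submodule.span R T) :
    v ∈ Submodule.span A (extendSet A T) := by
  obtain ⟨B, -, hB⟩ := exists_finset_coord b v
  rw [hB]
  exact sum_mem fun β _ => Submodule.smul_mem _ _ (extend_mem_span (hv β))

variable [IsDomain R]

/-- A vector killed by all the linear forms that kill a set is torsion modulo the span. -/
theorem exists_smul_mem_span {T : Set (ι → R)} {w : ι → R}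
    (h : ∀ c : ι → R, (∀ e ∈ T, ∑ a, c a * e a = 0) → ∑ a, c a * w a = 0) :
    ∃ r : R, r ≠ 0 ∧ r • w ∈ Submodule.span R T := by
  classical
  let K := FractionRing R
  let ψ : (ι → R) → ι → K := fun w a => algebraMap R K (w a)
  have hmem : ψ w ∈ Submodule.span K (extendSet K T) := by
    by_contra hcon
    -- Otherwise a linear form over the fraction field separates `w` from the span; clearing its
    -- denominators gives a form over `R` contradicting `h`.
    obtain ⟨φ, hφw, hφ⟩ := Submodule.exists_le_ker_of_notMem hcon
    obtain ⟨d, hd⟩ := IsLocalization.exist_integer_multiples_of_finite (nonZeroDivisors R)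
      fun a : ι => φ (Pi.single a 1)
    choose c hc using hd
    have hφc : ∀ u : ι → R, (d : R) • φ (ψ u) = algebraMap R K (∑ a, c a * u a) := by
      intro u
      have : ψ u = ∑ a, algebraMap R K (u a) • (Pi.single a 1 : ι → K) := by
        funext a
        simp [ψ, Finset.sum_apply, Pi.single_apply, Algebra.algebraMap_eq_smul_one]
      rw [this, map_sum, map_sum, Finset.smul_sum]
      refine Finset.sum_congr rfl fun a _ => ?_
      rw [map_smul, smul_comm, ← hc a, smul_eq_mul, map_mul, mul_comm]
    have hd0 : (d : R) ≠ 0 := nonZeroDivisors.coe_ne_zero d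
    have hw := h c fun e he => by
      have h0 : φ (ψ e) = 0 := hφ (Submodule.subset_span ⟨e, he, rfl⟩)
      have := hφc e
      rw [h0, smul_zero] at this
      exact (map_eq_zero_iff _ (IsFractionRing.injective R K)).mp this.symm
    have := hφc w
    rw [hw, map_zero, Algebra.smul_def] at this
    rcases mul_eq_zero.mp this with h1 | h1
    · exact hd0 ((map_eq_zero_iff _ (IsFractionRing.injective R K)).mp h1)
    · exact hφw h1
  obtain ⟨l, f, g, hg⟩ := Submodule.mem_span_set'.mp hmem
  choose e heT he using fun i => (g i).2
  obtain ⟨d, hd⟩ := IsLocalization.exist_integer_multiples_of_finite (nonZeroDivisors R) f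
  choose c hc using hd
  refine ⟨d, nonZeroDivisors.coe_ne_zero d, ?_⟩
  have : (d : R) • w = ∑ i, c i • e i := by
    funext a
    apply IsFractionRing.injective R K
    have h1 := congrFun hg a
    rw [Finset.sum_apply] at h1
    rw [Pi.smul_apply, smul_eq_mul, map_mul, Finset.sum_apply, map_sum]
    rw [show algebraMap R K (w a) = ψ w a from rfl, ← h1, Finset.mul_sum]
    refine Finset.sum_congr rfl fun i _ => ?_
    rw [Pi.smul_apply, Pi.smul_apply, smul_eq_mul, smul_eq_mul, map_mul, hc, ← he i,
      Algebra.smul_def, mul_assoc]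
  rw [this]
  exact sum_mem fun i _ => Submodule.smul_mem _ _ (Submodule.subset_span (heT i))

/-- In a module extended to a free algebra that is a domain, torsion elements are torsion over the
base ring. -/
theorem exists_algebraMap_smul_mem_span [IsDomain A] [Module.Free R A] {T : Set (ι → R)} {v : ι → A} {f : A}
    (hf : f ≠ 0) (hv : f • v ∈ Submodule.span A (extendSet A T)) :
    ∃ r : R, r ≠ 0 ∧ r • v ∈ Submodule.span A (extendSet A T) := by
  classical
  -- A form over `R` that kills `T` kills `f • v`, hence `v`, since `A` is a domain. It therefore
  -- kills each coordinate vector of `v`, which makes each of these torsion over `R`.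
  have hforms : ∀ c : ι → R, (∀ e ∈ T, ∑ a, c a * e a = 0) → ∑ a, c a • v a = 0 := by
    intro c hc
    have hkill : ∀ u ∈ Submodule.span A (extendSet A T), ∑ a, c a • u a = 0 := by
      intro u hu
      induction hu using Submodule.span_induction with
      | mem u hu =>
        obtain ⟨e, he, rfl⟩ := hu
        have := congrArg (algebraMap R A) (hc e he)
        simpa [map_sum, Algebra.smul_def] using this
      | zero => simp
      | add x y _ _ hx hy => simp [smul_add, Finset.sum_add_distrib, hx, hy]
      | smul d x _ hx =>
        simp only [Pi.smul_apply]
        simp_rw [smul_comm _ d]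
        rw [← Finset.smul_sum, hx, smul_zero]
    have := hkill _ hv
    simp only [Pi.smul_apply] at this
    simp_rw [smul_comm _ f] at this
    rw [← Finset.smul_sum, smul_eq_mul] at this
    exact (mul_eq_zero.mp this).resolve_left hf
  let b := Module.Free.chooseBasis R A
  have hcoord : ∀ β, ∃ r : R, r ≠ 0 ∧ r • (fun a => b.coord β (v a)) ∈ Submodule.span R T := by
    refine fun β => exists_smul_mem_span fun c hc => ?_
    have := congrArg (b.coord β) (hforms c hc)
    simpa only [map_sum, map_smul, smul_eq_mul, map_zero] using this
  choose r hr0 hr using hcoord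
  obtain ⟨B, hB, -⟩ := exists_finset_coord b v
  -- Only the finitely many coordinates in `B` are nonzero, so the product of their denominators
  -- serves for all.
  refine ⟨∏ β ∈ B, r β, Finset.prod_ne_zero_iff.mpr fun β _ => hr0 β,
    mem_span_of_coord_mem b fun β => ?_⟩
  have heq : (fun a => b.coord β (((∏ β ∈ B, r β) • v) a)) =
      (∏ β ∈ B, r β) • fun a => b.coord β (v a) := by
    funext a
    simp only [Pi.smul_apply, map_smul]
  rw [heq]
  by_cases hβ : β ∈ B
  · rw [← Finset.mul_prod_erase B r hβ, mul_comm, mul_smul]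
    exact Submodule.smul_mem _ _ (hr β)
  · rw [show (fun a => b.coord β (v a)) = 0 from funext (hB β hβ), smul_zero]
    exact zero_mem _

end FreeExtension

/-! ### Torsion as the kernel of localization, and the diagram -/

section Diagram

theorem mem_torsion_iff_exists_ne_zero {A X : Type*} [CommRing A] [IsDomain A] [AddCommGroup X]
    [Module A X] {x : X} : x ∈ Submodule.torsion A X ↔ ∃ r : A, r ≠ 0 ∧ r • x = 0 := by
  rw [Submodule.mem_torsion_iff]
  exact ⟨fun ⟨r, hr⟩ => ⟨r, nonZeroDivisors.coe_ne_zero r, hr⟩,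
    fun ⟨r, hr0, hr⟩ => ⟨⟨r, mem_nonZeroDivisors_of_ne_zero hr0⟩, hr⟩⟩

theorem map_mem_torsion {A X Y : Type*} [CommRing A] [IsDomain A] [AddCommGroup X] [Module A X]
    [AddCommGroup Y] [Module A Y] (f : X →ₗ[A] Y) {x : X} (hx : x ∈ Submodule.torsion A X) :
    f x ∈ Submodule.torsion A Y := by
  rw [mem_torsion_iff_exists_ne_zero] at hx ⊢
  obtain ⟨r, hr0, hr⟩ := hx
  exact ⟨r, hr0, by rw [← map_smul, hr, map_zero]⟩

theorem mem_torsion_of_map_mem {A X Y : Type*} [CommRing A] [IsDomain A] [AddCommGroup X]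
    [Module A X] [AddCommGroup Y] [Module A Y] {f : X →ₗ[A] Y} (hf : Function.Injective f) {x : X}
    (hx : f x ∈ Submodule.torsion A Y) : x ∈ Submodule.torsion A X := by
  rw [mem_torsion_iff_exists_ne_zero] at hx ⊢
  obtain ⟨r, hr0, hr⟩ := hx
  exact ⟨r, hr0, hf (by rw [map_smul, hr, map_zero])⟩

theorem exact_subtype_mk_fractionRing {A X : Type*} [CommRing A] [IsDomain A] [AddCommGroup X]
    [Module A X] {T : Submodule A X} (hT : T = Submodule.torsion A X) :
    Function.Exact T.subtype (TensorProduct.mk A (FractionRing A) X 1) := by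
  intro x
  rw [IsLocalizedModule.eq_zero_iff (nonZeroDivisors A), ← Submodule.mem_torsion_iff, ← hT]
  simp

/-- The condition on `f` asks only for one good preimage of each element, so that it also covers a
map that need not be injective, as in the reading over `D`. -/
theorem commExactDiagram_of_eq_torsion {A X Y : Type*} [CommRing A] [IsDomain A] [AddCommGroup X]
    [Module A X] [AddCommGroup Y] [Module A Y] {T : Submodule A X} {T' : Submodule A Y}
    (hT : T = Submodule.torsion A X) (hT' : T' = Submodule.torsion A Y) {f : X →ₗ[A] Y}
    (hf : ∀ y, ∃ x, f x = y ∧ (y ∈ T' → x ∈ T)) :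
    CommExactDiagram (FractionRing A) T T' f := by
  have hmaps : ∀ x ∈ T, f x ∈ T' := by
    subst hT hT'
    exact fun x hx => map_mem_torsion f hx
  have hsurj : Function.Surjective f := fun y => (hf y).imp fun _ h => h.1
  refine ⟨f.restrict hmaps, rfl, ?_, T.injective_subtype, exact_subtype_mk_fractionRing hT,
    T'.injective_subtype, exact_subtype_mk_fractionRing hT', ?_, hsurj,
    LinearMap.lTensor_surjective _ hsurj⟩
  · ext x
    simp
  · rintro ⟨y, hy⟩
    obtain ⟨x, rfl, hx⟩ := hf y
    exact ⟨⟨x, hx hy⟩, rfl⟩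

end Diagram

/-! ### Freeness of `D` over `D'` -/

section SubringOfOperators

variable (k : Type*) [Field k] (n p : ℕ)

/-- The ring of operators is free over the subring in the first derivations. -/
theorem free_subOp : Module.Free (SubOp k n p) (Op k n) := by
  classical
  let s : Set (Fin n) := {j : Fin n | (j : ℕ) < p}
  let e₁ : MvPolynomial s k ≃ₐ[k] SubOp k n p := (supportedEquivMvPolynomial s).symm
  let e : MvPolynomial (sᶜ : Set (Fin n)) (MvPolynomial s k) ≃ₐ[k] Op k n :=
    (sumAlgEquiv k (sᶜ : Set (Fin n)) s).symm.trans
      (renameEquiv k ((Equiv.sumComm _ _).trans (Equiv.Set.sumCompl s)))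
  have he : ∀ f : MvPolynomial s k, e (C f) = (e₁ f : Op k n) := by
    intro f
    have : (e.toAlgHom.comp (IsScalarTower.toAlgHom k (MvPolynomial s k)
        (MvPolynomial (sᶜ : Set (Fin n)) (MvPolynomial s k)))) =
        (SubOp k n p).val.comp e₁.toAlgHom := by
      refine algHom_ext fun j => ?_
      have h1 : (e₁ (X j) : Op k n) = X (j : Fin n) := supportedEquivMvPolynomial_symm_X s j
      have h2 : e (C (X j)) = X (j : Fin n) := by
        simp [e]
      exact h2.trans h1.symm
    exact DFunLike.congr_fun this f
  have := RingHomInvPair.of_ringEquiv e₁.toRingEquiv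
  have := RingHomInvPair.of_ringEquiv e₁.toRingEquiv.symm
  let e₂ : MvPolynomial (sᶜ : Set (Fin n)) (MvPolynomial s k)
      ≃ₛₗ[(e₁.toRingEquiv : MvPolynomial s k →+* SubOp k n p)] Op k n :=
    { e.toAddEquiv with
      map_smul' := fun c x => by
        show e (c • x) = (e₁ c : Op k n) * e x
        rw [← he, ← map_mul, smul_eq_C_mul] }
  exact Module.Free.of_equiv e₂

end SubringOfOperators

/-! ### Comparison of the two readings of `M_r` -/

namespace FirstOrderSystem

variable {k : Type*} [Field k] {n m : ℕ} (S : FirstOrderSystem k n m)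

/-- The equations of class `≤ p`, as row vectors of operators in the first `p` derivations. -/
def subEqns (p : ℕ) : Set (Fin m → SubOp k n p) :=
  {v | (fun a => (v a : Op k n)) ∈ S.eqnsUpTo p}

theorem extendSet_subEqns (p : ℕ) :
    extendSet (Op k n) (S.subEqns p) = (S.eqnsUpTo p : Set (Fin m → Op k n)) := by
  ext v
  constructor
  · rintro ⟨w, hw, rfl⟩
    exact hw
  · exact fun hv => ⟨fun a => ⟨v a, hv.2 a⟩, hv, rfl⟩

theorem mk_eq_zero_iff_fullSubMod {p : ℕ} {v : Fin m → Op k n} :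
    (Submodule.Quotient.mk v : S.FullSubMod p) = 0 ↔
      v ∈ Submodule.span (Op k n) (extendSet (Op k n) (S.subEqns p)) := by
  rw [Submodule.Quotient.mk_eq_zero, extendSet_subEqns]

/-- The canonical map from the module over `D'` to the module over `D`. -/
def subModToFull (p : ℕ) : S.SubMod p →ₗ[SubOp k n p] S.FullSubMod p :=
  Submodule.liftQ _
    ((Submodule.mkQ (Submodule.span (Op k n)
        (S.eqnsUpTo p : Set (Fin m → Op k n)))).restrictScalars (SubOp k n p) ∘ₗ
      LinearMap.compLeft (Algebra.linearMap (SubOp k n p) (Op k n)) (Fin m))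
    (Submodule.span_le.mpr fun _ hv =>
      (Submodule.Quotient.mk_eq_zero _).mpr (Submodule.subset_span hv))

theorem fullSpecialize_subModToFull (p : ℕ) (x : S.SubMod p) :
    S.fullSpecialize p (S.subModToFull p x) = S.specialize p x := by
  obtain ⟨v, rfl⟩ := Submodule.Quotient.mk_surjective _ x
  rfl

theorem mem_torsion_fullSubMod_iff {p : ℕ} {x : S.FullSubMod p} :
    x ∈ Submodule.torsion (Op k n) (S.FullSubMod p) ↔
      x ∈ Submodule.torsion (SubOp k n p) (S.FullSubMod p) := by
  rw [mem_torsion_iff_exists_ne_zero, mem_torsion_iff_exists_ne_zero]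
  constructor
  · rintro ⟨f, hf0, hf⟩
    have := free_subOp k n p
    obtain ⟨v, rfl⟩ := Submodule.Quotient.mk_surjective _ x
    obtain ⟨r, hr0, hr⟩ := exists_algebraMap_smul_mem_span hf0
      (S.mk_eq_zero_iff_fullSubMod.mp hf)
    exact ⟨r, hr0, S.mk_eq_zero_iff_fullSubMod.mpr hr⟩
  · rintro ⟨r, hr0, hr⟩
    exact ⟨r, fun h => hr0 (Subtype.ext h), hr⟩

/-- A torsion element is killed by some `r ≠ 0` of the subring, and `r` acts on each coordinate over
a basis of `D`; these coordinates are torsion in the module over the subring, hence zero there. -/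
theorem torsion_fullSubMod_eq_bot {p : ℕ}
    (h : Submodule.torsion (SubOp k n p) (S.SubMod p) = ⊥) :
    Submodule.torsion (Op k n) (S.FullSubMod p) = ⊥ := by
  refine (Submodule.eq_bot_iff _).mpr fun x hx => ?_
  rw [mem_torsion_fullSubMod_iff, mem_torsion_iff_exists_ne_zero] at hx
  obtain ⟨r, hr0, hr⟩ := hx
  have := free_subOp k n p
  let b := Module.Free.chooseBasis (SubOp k n p) (Op k n)
  obtain ⟨v, rfl⟩ := Submodule.Quotient.mk_surjective _ x
  refine S.mk_eq_zero_iff_fullSubMod.mpr (mem_span_of_coord_mem b fun β => ?_)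
  have h1 : (fun a => b.coord β ((r • v) a)) ∈ Submodule.span (SubOp k n p) (S.subEqns p) :=
    coord_mem_span b (S.mk_eq_zero_iff_fullSubMod.mp hr) β
  have h2 : (fun a => b.coord β ((r • v) a)) = r • fun a => b.coord β (v a) := by
    funext a
    simp only [Pi.smul_apply, map_smul]
  rw [h2] at h1
  have h3 : (Submodule.Quotient.mk (fun a => b.coord β (v a)) : S.SubMod p) ∈
      Submodule.torsion (SubOp k n p) (S.SubMod p) :=
    mem_torsion_iff_exists_ne_zero.mpr ⟨r, hr0, (Submodule.Quotient.mk_eq_zero _).mpr h1⟩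
  rw [h, Submodule.mem_bot] at h3
  exact (Submodule.Quotient.mk_eq_zero _).mp h3

end FirstOrderSystem

end PureModules

end

/-! ### The theorem -/

open PureModules in
theorem theorem5p9 {k : Type*} [Field k] (n m r : ℕ) (S : FirstOrderSystem k n m)
    (hS : S.IsInvolutive) (hr : S.cd = r) :
    -- the diagram for the module `M_r` over `D' = k[d_1, ..., d_{n-r}]`
    CommExactDiagram (RatField k n (n - r))
      (Submodule.torsion (SubOp k n (n - r)) (S.SubMod (n - r)))
      ((tSub k n S.Mod r).restrictScalars (SubOp k n (n - r)))
      (S.specialize (n - r)) ∧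
    -- the diagram for the module `M_r` over `D = k[d_1, ..., d_n]`
    CommExactDiagram (RatField k n (n - r))
      ((Submodule.torsion (Op k n) (S.FullSubMod (n - r))).restrictScalars (SubOp k n (n - r)))
      ((tSub k n S.Mod r).restrictScalars (SubOp k n (n - r)))
      ((S.fullSpecialize (n - r)).restrictScalars (SubOp k n (n - r))) ∧
    -- purity
    (IsPure k n S.Mod r ↔ Submodule.torsion (SubOp k n (n - r)) (S.SubMod (n - r)) = ⊥) ∧
    (IsPure k n S.Mod r ↔ Submodule.torsion (Op k n) (S.FullSubMod (n - r)) = ⊥) := by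
  obtain ⟨hnr, hsolved⟩ := FirstOrderSystem.solvedFrom_of_cd_eq hS hr
  have hinj := FirstOrderSystem.specialize_injective hS (Nat.sub_le n r)
  have hsurj := FirstOrderSystem.specialize_surjective hsolved
  have htors : (tSub k n S.Mod r).restrictScalars (SubOp k n (n - r)) =
      Submodule.torsion (SubOp k n (n - r)) S.Mod := by
    ext z
    rw [Submodule.restrictScalars_mem, mem_tSub_iff hnr hsolved S.span_gen,
      mem_torsion_iff_exists_ne_zero]
    exact ⟨fun ⟨f, hf, hf0, hz⟩ => ⟨⟨f, hf⟩, fun h => hf0 (congrArg Subtype.val h), hz⟩,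
      fun ⟨f, hf0, hz⟩ => ⟨f, f.2, fun h => hf0 (Subtype.ext h), hz⟩⟩
  have hlift : ∀ x : S.SubMod (n - r),
      S.specialize (n - r) x ∈ (tSub k n S.Mod r).restrictScalars (SubOp k n (n - r)) →
      x ∈ Submodule.torsion (SubOp k n (n - r)) (S.SubMod (n - r)) := by
    rw [htors]
    exact fun x hx => mem_torsion_of_map_mem hinj hx
  have hfull : ∀ x ∈ Submodule.torsion (SubOp k n (n - r)) (S.SubMod (n - r)),
      S.subModToFull (n - r) x ∈ Submodule.torsion (Op k n) (S.FullSubMod (n - r)) := by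
    intro x hx
    rw [FirstOrderSystem.mem_torsion_fullSubMod_iff]
    exact map_mem_torsion _ hx
  have hpure : IsPure k n S.Mod r ↔
      Submodule.torsion (SubOp k n (n - r)) (S.SubMod (n - r)) = ⊥ := by
    rw [isPure_iff hnr hsolved S.span_gen]
    constructor
    · intro h
      rw [h] at htors
      refine (Submodule.eq_bot_iff _).mpr fun x hx => hinj ?_
      have := map_mem_torsion (S.specialize (n - r)) hx
      rw [← htors] at this
      rw [map_zero]
      exact this
    · intro h
      refine (Submodule.eq_bot_iff _).mpr fun z hz => ?_
      obtain ⟨x, rfl⟩ := hsurj z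
      have := hlift x hz
      rw [h, Submodule.mem_bot] at this
      rw [this, map_zero]
  refine ⟨commExactDiagram_of_eq_torsion rfl htors fun y => ?_,
    commExactDiagram_of_eq_torsion ?_ htors fun y => ?_, hpure, hpure.trans ⟨?_, fun h => ?_⟩⟩
  · obtain ⟨x, rfl⟩ := hsurj y
    exact ⟨x, rfl, hlift x⟩
  · ext x
    exact S.mem_torsion_fullSubMod_iff
  · obtain ⟨x, rfl⟩ := hsurj y
    -- The preimage is taken from the module over `D'`, where membership in `t_r(M)` forces torsion.
    exact ⟨S.subModToFull (n - r) x, S.fullSpecialize_subModToFull _ x,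
      fun h => hfull x (hlift x h)⟩
  · exact S.torsion_fullSubMod_eq_bot
  -- The injective map from the module over `D'` to `M` factors through the module over `D`, where
  -- torsion elements vanish.
  · refine (Submodule.eq_bot_iff _).mpr fun x hx => hinj ?_
    have := hfull x hx
    rw [h, Submodule.mem_bot] at this
    rw [← S.fullSpecialize_subModToFull, this, map_zero, map_zero]
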